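/- Let $K$ be a quartic CM-field that is not biquadratic (i.e. not Galois over $\mathbb Q$ with group $(\mathbb Z/2)^2$), with maximal real subfield $K_0$ and complex conjugation $x\mapsto\overline x$, and let $\Phi$ be a CM-type of $K$ with values in $\mathbb C$. Let $K^r\subset\mathbb C$ be the reflex field, generated by the values of $N_\Phi(x)=\prod_{\phi\in\Phi}\phi(x)$, let $\Phi^r$ be the reflex type (the set of restrictions to $K^r$ of $\psi^{-1}$, where $\psi$ runs over the embeddings into $\mathbb C$ of the normal closure of $K$ that extend an element of $\Phi$), and let $N_{\Phi^r}=\prod_{\chi\in\Phi^r}\chi$ be the reflex type norm on elements and ideals of $K^r$. Let $\mathcal O$ and $\mathcal O'$ be orders of $K$ stable under complex conjugation, put $\mathcal O^\circ=\mathcal O\cap\mathcal O'$ and $f=[\mathcal O_K:\mathcal O^\circ]$, and write $R_0=R\cap K_0$ for an order $R$ of $K$ and $\mu_{\mathcal O}$ for the group of roots of unity in $\mathcal O$. If $K\cong\mathbb Q(\zeta_5)$, assume moreover that $\mathcal O$ or $\mathcal O'$ is the maximal order. For $R\in\{\mathcal O,\mathcal O'\}$ let $I_R$ be the group of pairs $(\mathfrak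 a,\alpha)$ where $\mathfrak a$ is an invertible fractional ideal of $R$ coprime to $f$ and $\alpha\in K_0$ is totally positive with $\mathfrak a\overline{\mathfrak a}=\alpha R$; let $P_R$ be its subgroup of pairs $(xR,x\overline x)$ with $x\in K^\times$; put $\mathfrak C(R)=I_R/P_R$. Let $S_R$ be the kernel of the map sending an invertible fractional ideal $\mathfrak a$ of $\mathcal O_{K^r}$ coprime to $f$ to the class of $(N_{\Phi^r}(\mathfrak a),N_{K^r/\mathbb Q}(\mathfrak a))$ in $\mathfrak C(R)$, where $N_{\Phi^r}(\mathfrak a)$ is viewed as an ideal of $R$ through the bijection $\mathfrak b\mapsto\mathfrak b\mathcal O_K$ between invertible ideals of $R$ and of $\mathcal O_K$ coprime to $f$. If $S_{\mathcal O}\subset S_{\mathcal O'}$, then every element $x$ of the kernel of the relative norm map $$\psi:\frac{(\mathcal O/f\mathcal O_K)^\times}{(\mathcal O^\circ/f\mathcal O_K)^\times\,\mu_{\mathcal O}}\longrightarrow\frac{(\mathcal O_0/f\mathcal O_{K_0})^\times}{(\mathcal O^\circ_0/f\mathcal O_{K_0})^\times},\qquad x\mapsto x\overline x,$$ satisfies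 $x^2=1$; that is, the kernel has exponent at most two. -/

import Mathlib

open NumberField
open scoped nonZeroDivisors

namespace QuarticCM

noncomputable section

/-! ### CM-types, reflex fields and type norms -/

section Types

variable {K : Type*} [Field K] [NumberField K]

/-- A CM-type of `K` with values in `ℂ`: a complete set of representatives for the embeddings
`K → ℂ` up to complex conjugation. -/
def IsCMType (Φ : Finset (K →+* ℂ)) : Prop :=
  ∀ φ : K →+* ℂ, Xor (φ ∈ Φ) (ComplexEmbedding.conjugate φ ∈ Φ)

/-- The type norm `N_Φ(x) = ∏_{φ ∈ Φ} φ(x)`. -/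
def typeNorm (Φ : Finset (K →+* ℂ)) (x : K) : ℂ := ∏ φ ∈ Φ, φ x

/-- The reflex field: the subfield of `ℂ` generated by the image of the type norm. -/
def reflexField (Φ : Finset (K →+* ℂ)) : IntermediateField ℚ ℂ :=
  IntermediateField.adjoin ℚ (Set.range (typeNorm Φ))

variable (K) in
/-- The normal closure of `K` over `ℚ`, as an extension of `K`. -/
abbrev NormalClosure : Type _ := IntermediateField.normalClosure ℚ K (AlgebraicClosure K)

lemma reflexField_le_normalClosure (Φ : Finset (K →+* ℂ)) :
    reflexField Φ ≤ IntermediateField.normalClosure ℚ K ℂ := by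
  refine IntermediateField.adjoin_le_iff.mpr ?_
  rintro _ ⟨x, rfl⟩
  refine prod_mem fun φ _ => ?_
  exact (AlgHom.fieldRange_le_normalClosure φ.toRatAlgHom) ⟨x, rfl⟩

instance reflexField.numberField (Φ : Finset (K →+* ℂ)) : NumberField (reflexField Φ) where
  to_charZero := inferInstance
  to_finiteDimensional :=
    FiniteDimensional.of_injective
      (IntermediateField.inclusion (reflexField_le_normalClosure Φ)).toLinearMap
      (IntermediateField.inclusion (reflexField_le_normalClosure Φ)).toRingHom.injective

/-- The reflex type: the embeddings `χ` of the reflex field into the normal closure `L` of `K`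
of the form `ψ⁻¹` restricted to the reflex field, where `ψ : L → ℂ` extends an element of `Φ`. -/
def reflexType (Φ : Finset (K →+* ℂ)) : Finset (reflexField Φ →+* NormalClosure K) :=
  (Set.toFinite {χ : reflexField Φ →+* NormalClosure K | ∃ ψ : NormalClosure K →+* ℂ,
    ψ.comp (algebraMap K (NormalClosure K)) ∈ Φ ∧ ∀ z : reflexField Φ, ψ (χ z) = z}).toFinset

end Types

/-! ### Orders and their ideals -/

/-- The group of invertible fractional ideals (in `F`) of `R` that are coprime to `f`: the group
generated by the invertible integral ideals `I` with `I + fR = R`. -/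
def coprimeIdeals (R F : Type*) [CommRing R] [Field F] [Algebra R F] (f : ℕ) :
    Subgroup (FractionalIdeal R⁰ F)ˣ :=
  Subgroup.closure {𝔞 | ∃ I : Ideal R, I ⊔ Ideal.span {(f : R)} = ⊤ ∧
    (𝔞 : FractionalIdeal R⁰ F) = (I : FractionalIdeal R⁰ F)}

/-- The ideal `f 𝓞_F ∩ R` of a subring `R` of `𝓞_F`; this is `f 𝓞_F` as soon as
`f 𝓞_F ⊆ R`. -/
def modIdeal {F : Type*} [Field F] (R : Subring (𝓞 F)) (f : ℕ) : Ideal R :=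
  (Ideal.span {(f : 𝓞 F)}).comap R.subtype

instance modIdeal.isMulCommutative {F : Type*} [Field F] (R : Subring (𝓞 F)) (f : ℕ) :
    IsMulCommutative (R ⧸ modIdeal R f)ˣ :=
  ⟨⟨fun a b => Units.ext (mul_comm (a : R ⧸ modIdeal R f) b)⟩⟩

lemma modIdeal_le_comap {F : Type*} [Field F] {A B : Subring (𝓞 F)} (h : A ≤ B) (f : ℕ) :
    modIdeal A f ≤ (modIdeal B f).comap (Subring.inclusion h) := fun _ hx => hx

/-- The subgroup `(A / f 𝓞_F)ˣ` of `(B / f 𝓞_F)ˣ`, for `A ⊆ B ⊆ 𝓞_F`. -/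
def unitsSubgroup {F : Type*} [Field F] {A B : Subring (𝓞 F)} (h : A ≤ B) (f : ℕ) :
    Subgroup (B ⧸ modIdeal B f)ˣ :=
  (Units.map (Ideal.quotientMap (modIdeal B f) (Subring.inclusion h)
    (modIdeal_le_comap h f)).toMonoidHom).range

/-- The image of the group `μ_B` of roots of unity of `B` in `(B / f 𝓞_F)ˣ`. -/
def rootsSubgroup {F : Type*} [Field F] (B : Subring (𝓞 F)) (f : ℕ) :
    Subgroup (B ⧸ modIdeal B f)ˣ :=
  (CommGroup.torsion Bˣ).map (Units.map (Ideal.Quotient.mk (modIdeal B f)).toMonoidHom)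

variable (K : Type*) [Field K] [NumberField K] [IsCMField K]

/-- An order of the CM-field `K` (a subring of finite index of `𝓞 K`) that is stable under
complex conjugation. -/
structure ConjOrder where
  toSubring : Subring (𝓞 K)
  finiteIndex : toSubring.toAddSubgroup.FiniteIndex
  conj_mem : ∀ x ∈ toSubring, IsCMField.ringOfIntegersComplexConj K x ∈ toSubring

variable {K}

namespace ConjOrder

/-- The intersection of two orders. -/
def inter (O O' : ConjOrder K) : ConjOrder K where
  toSubring := O.toSubring ⊓ O'.toSubring
  finiteIndex := by
    have := O.finiteIndex
    have := O'.finiteIndex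
    exact (inferInstance :
      (O.toSubring.toAddSubgroup ⊓ O'.toSubring.toAddSubgroup).FiniteIndex)
  conj_mem x hx := ⟨O.conj_mem x hx.1, O'.conj_mem x hx.2⟩

/-- The index `[𝓞 K : O]`. -/
def index (O : ConjOrder K) : ℕ := O.toSubring.toAddSubgroup.index

/-- The order `O₀ = O ∩ K₀` of the maximal real subfield `K₀`. -/
def real (O : ConjOrder K) : Subring (𝓞 (maximalRealSubfield K)) :=
  O.toSubring.comap (algebraMap (𝓞 (maximalRealSubfield K)) (𝓞 K))

lemma real_mono {A B : ConjOrder K} (h : A.toSubring ≤ B.toSubring) : A.real ≤ B.real :=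
  fun _ hx => h hx

end ConjOrder

/-! ### The polarised ideal class group -/

/-- The complex conjugate `𝔞̄` of a fractional ideal, as an `O`-submodule of `K`. -/
def conjIdeal (O : ConjOrder K) (𝔞 : FractionalIdeal O.toSubring⁰ K) :
    Submodule O.toSubring K :=
  Submodule.span O.toSubring (IsCMField.complexConj K '' (𝔞 : Set K))

lemma conjIdeal_mul (O : ConjOrder K) (𝔞 𝔟 : FractionalIdeal O.toSubring⁰ K) :
    conjIdeal O (𝔞 * 𝔟) = conjIdeal O 𝔞 * conjIdeal O 𝔟 := by
  refine le_antisymm ?_ ?_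
  · refine Submodule.span_le.mpr ?_
    rintro _ ⟨x, hx, rfl⟩
    have hx' : x ∈ (𝔞 : Submodule O.toSubring K) * (𝔟 : Submodule O.toSubring K) := by
      rw [← FractionalIdeal.coe_mul]; exact hx
    refine Submodule.mul_induction_on hx' (fun a ha b hb => ?_) (fun a b ha hb => ?_)
    · rw [map_mul]
      exact Submodule.mul_mem_mul (Submodule.subset_span ⟨a, ha, rfl⟩)
        (Submodule.subset_span ⟨b, hb, rfl⟩)
    · rw [map_add]
      exact Submodule.add_mem _ ha hb
  · rw [conjIdeal, conjIdeal, Submodule.span_mul_span]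
    refine Submodule.span_le.mpr ?_
    rintro _ ⟨_, ⟨a, ha, rfl⟩, _, ⟨b, hb, rfl⟩, rfl⟩
    refine Submodule.subset_span ⟨a * b, ?_, map_mul _ _ _⟩
    exact FractionalIdeal.mul_mem_mul ha hb

lemma conjIdeal_one (O : ConjOrder K) : conjIdeal O 1 = 1 := by
  refine le_antisymm ?_ ?_
  · refine Submodule.span_le.mpr ?_
    rintro _ ⟨x, hx, rfl⟩
    obtain ⟨a, rfl⟩ := (FractionalIdeal.mem_one_iff _).mp hx
    exact Submodule.mem_one.mpr ⟨⟨_, O.conj_mem a a.2⟩, rfl⟩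
  · rw [Submodule.one_le]
    exact Submodule.subset_span ⟨1, FractionalIdeal.one_mem_one _, map_one _⟩

/-- `I_O`: pairs `(𝔞, α)` of an invertible fractional ideal `𝔞` of `O` coprime to `f` and a
totally positive `α ∈ K₀ˣ` with `𝔞 𝔞̄ = α O`. -/
def pairGroup (O : ConjOrder K) (f : ℕ) :
    Subgroup ((FractionalIdeal O.toSubring⁰ K)ˣ × (maximalRealSubfield K)ˣ) where
  carrier := {p | p.1 ∈ coprimeIdeals O.toSubring K f ∧
    (∀ φ : maximalRealSubfield K →+* ℝ, 0 < φ p.2) ∧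
    ((p.1 : FractionalIdeal O.toSubring⁰ K) : Submodule O.toSubring K) * conjIdeal O p.1 =
      Submodule.span O.toSubring {((p.2 : maximalRealSubfield K) : K)}}
  one_mem' := by
    refine ⟨one_mem _, fun φ => by simp, ?_⟩
    simp [conjIdeal_one, ← Submodule.one_eq_span]
  mul_mem' := by
    rintro p q ⟨hp1, hp2, hp3⟩ ⟨hq1, hq2, hq3⟩
    refine ⟨mul_mem hp1 hq1, fun φ => ?_, ?_⟩
    · simpa using mul_pos (hp2 φ) (hq2 φ)
    · simp only [Prod.fst_mul, Prod.snd_mul, Units.val_mul, FractionalIdeal.coe_mul,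
        conjIdeal_mul]
      rw [mul_mul_mul_comm, hp3, hq3, Submodule.span_mul_span]
      simp
  inv_mem' := by
    rintro p ⟨hp1, hp2, hp3⟩
    refine ⟨inv_mem hp1, fun φ => ?_, ?_⟩
    · simpa using hp2 φ
    · have hα : ((p.2 : maximalRealSubfield K) : K) ≠ 0 := by simp
      have h1 : ((p.1⁻¹ : (FractionalIdeal O.toSubring⁰ K)ˣ) : FractionalIdeal O.toSubring⁰ K) *
          p.1 = 1 := by simp
      have h2 : ((((p.1⁻¹ : (FractionalIdeal O.toSubring⁰ K)ˣ) :
          FractionalIdeal O.toSubring⁰ K) : Submodule O.toSubring K) *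
          conjIdeal O ((p.1⁻¹ : (FractionalIdeal O.toSubring⁰ K)ˣ) :
            FractionalIdeal O.toSubring⁰ K)) *
          Submodule.span O.toSubring {((p.2 : maximalRealSubfield K) : K)} = 1 := by
        rw [← hp3, mul_mul_mul_comm, ← FractionalIdeal.coe_mul, ← conjIdeal_mul, h1,
          conjIdeal_one, FractionalIdeal.coe_one, mul_one]
      have h3 : Submodule.span O.toSubring {((p.2 : maximalRealSubfield K) : K)} *
          Submodule.span O.toSubring {((p.2 : maximalRealSubfield K) : K)⁻¹} = 1 := by
        rw [Submodule.span_mul_span, Set.singleton_mul_singleton, mul_inv_cancel₀ hα,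
          Submodule.one_eq_span]
      have h4 := left_inv_eq_right_inv h2 h3
      simpa using h4

/-- `P_O`: the subgroup of pairs `(xO, x x̄)` with `x ∈ Kˣ` (and `xO` coprime to `f`). -/
def principalPairs (O : ConjOrder K) (f : ℕ) : Subgroup (pairGroup O f) where
  carrier := {p | ∃ x : Kˣ,
    ((p.1.1 : FractionalIdeal O.toSubring⁰ K) : Submodule O.toSubring K) =
      Submodule.span O.toSubring {(x : K)} ∧
    ((p.1.2 : maximalRealSubfield K) : K) = x * IsCMField.complexConj K x}
  one_mem' := ⟨1, by simp [Submodule.one_eq_span], by simp⟩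
  mul_mem' := by
    rintro p q ⟨x, hx1, hx2⟩ ⟨y, hy1, hy2⟩
    refine ⟨x * y, ?_, ?_⟩
    · simp only [Subgroup.coe_mul, Prod.fst_mul, Units.val_mul, FractionalIdeal.coe_mul]
      rw [hx1, hy1, Submodule.span_mul_span, Set.singleton_mul_singleton]
    · simp only [Subgroup.coe_mul, Prod.snd_mul, Units.val_mul, map_mul, Subfield.coe_mul]
      rw [hx2, hy2, mul_mul_mul_comm]
  inv_mem' := by
    rintro p ⟨x, hx1, hx2⟩
    refine ⟨x⁻¹, ?_, ?_⟩
    · have h1 : ((((p⁻¹ : pairGroup O f).1.1 : FractionalIdeal O.toSubring⁰ K)) :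
          Submodule O.toSubring K) * Submodule.span O.toSubring {(x : K)} = 1 := by
        rw [← hx1, ← FractionalIdeal.coe_mul]
        simp
      have h2 : Submodule.span O.toSubring {(x : K)} *
          Submodule.span O.toSubring {((x⁻¹ : Kˣ) : K)} = 1 := by
        rw [Submodule.span_mul_span, Set.singleton_mul_singleton, Units.mul_inv,
          Submodule.one_eq_span]
      exact left_inv_eq_right_inv h1 h2
    · simp only [Subgroup.coe_inv, Prod.snd_inv, Units.val_inv_eq_inv_val, Subfield.coe_inv,
        map_inv₀]
      rw [hx2, mul_inv]

/-- The polarised ideal class group `I_O / P_O`. -/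
abbrev PolarisedClassGroup (O : ConjOrder K) (f : ℕ) : Type _ :=
  pairGroup O f ⧸ principalPairs O f

/-- `𝔟` is the reflex type norm of `𝔞`: with `L` the normal closure of `K`, the ideals `𝔟 𝓞_L`
and `∏_χ χ(𝔞) 𝓞_L` are equal, where `χ` runs through the reflex type. Since extension of
ideals to `𝓞_L` is injective on the invertible ideals of `O` coprime to `f`, where `f 𝓞_K ⊆ O`,
this determines such a `𝔟`. -/
def IsReflexNorm (Φ : Finset (K →+* ℂ)) (O : ConjOrder K)
    (𝔞 : FractionalIdeal (𝓞 (reflexField Φ))⁰ (reflexField Φ))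
    (𝔟 : FractionalIdeal O.toSubring⁰ K) : Prop :=
  Submodule.span (𝓞 (NormalClosure K)) (algebraMap K (NormalClosure K) '' (𝔟 : Set K)) =
    ∏ χ ∈ reflexType Φ,
      Submodule.span (𝓞 (NormalClosure K)) (χ '' (𝔞 : Set (reflexField Φ)))

/-- `S_O`: the kernel of the map from the group of ideals of the reflex field coprime to `f` to the
polarised ideal class group of `O` that sends `𝔞` to the class of
`(N_{Φ^r}(𝔞), N_{K^r/ℚ}(𝔞))`. -/
def reflexKernel (Φ : Finset (K →+* ℂ)) (O : ConjOrder K) (f : ℕ) :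
    Set (coprimeIdeals (𝓞 (reflexField Φ)) (reflexField Φ) f) :=
  {𝔞 | ∃ p : pairGroup O f,
    IsReflexNorm Φ O (𝔞 : (FractionalIdeal (𝓞 (reflexField Φ))⁰ (reflexField Φ))ˣ) p.1.1 ∧
    (p.1.2 : maximalRealSubfield K) =
      algebraMap ℚ (maximalRealSubfield K) (FractionalIdeal.absNorm
        ((𝔞 : (FractionalIdeal (𝓞 (reflexField Φ))⁰ (reflexField Φ))ˣ) :
          FractionalIdeal (𝓞 (reflexField Φ))⁰ (reflexField Φ))) ∧
    (QuotientGroup.mk p : PolarisedClassGroup O f) = 1}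

/-! ### The relative norm map -/

lemma algebraMap_norm (x : 𝓞 K) :
    algebraMap (𝓞 (maximalRealSubfield K)) (𝓞 K)
      (RingOfIntegers.norm (maximalRealSubfield K) x) =
      x * IsCMField.ringOfIntegersComplexConj K x := by
  classical
  have hne : (1 : Gal(K/maximalRealSubfield K)) ≠ IsCMField.complexConj K :=
    (IsCMField.complexConj_ne_one K).symm
  have huniv : (Finset.univ : Finset Gal(K/maximalRealSubfield K)) =
      {1, IsCMField.complexConj K} := by
    symm
    rw [← Finset.card_eq_iff_eq_univ, Finset.card_pair hne, ← Nat.card_eq_fintype_card,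
      IsGalois.card_aut_eq_finrank, Algebra.IsQuadraticExtension.finrank_eq_two]
  apply RingOfIntegers.ext
  have h := Algebra.norm_eq_prod_automorphisms (maximalRealSubfield K) (x : K)
  rw [huniv, Finset.prod_pair hne] at h
  exact h

/-- The relative norm `N_{K/K₀} : O → O₀`. -/
def normHom (O : ConjOrder K) : O.toSubring →* O.real where
  toFun x := ⟨RingOfIntegers.norm (maximalRealSubfield K) (x : 𝓞 K), by
    change algebraMap _ (𝓞 K) _ ∈ O.toSubring
    rw [algebraMap_norm]
    exact O.toSubring.mul_mem x.2 (O.conj_mem _ x.2)⟩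
  map_one' := by ext1; simp
  map_mul' x y := by ext1; simp

lemma normHom_congr (O : ConjOrder K) (f : ℕ) (x y : O.toSubring)
    (h : x - y ∈ modIdeal O.toSubring f) :
    normHom O x - normHom O y ∈ modIdeal O.real f := by
  obtain ⟨z, hz⟩ := Ideal.mem_span_singleton'.mp h
  have hx : (x : 𝓞 K) = y + z * f := by rw [hz]; simp
  set c := IsCMField.ringOfIntegersComplexConj K with hc
  -- the difference of the norms is `f` times an element fixed by complex conjugation
  have hcc : ∀ w : 𝓞 K, c (c w) = w := fun w => by
    apply RingOfIntegers.ext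
    exact IsCMField.complexConj_apply_apply K (w : K)
  obtain ⟨w, hw⟩ := (IsCMField.ringOfIntegersComplexConj_eq_self_iff K
    ((y : 𝓞 K) * c z + z * c y + f * (z * c z))).mp (by
      rw [← hc]
      simp only [map_add, map_mul, hcc, map_natCast]
      ring)
  refine Ideal.mem_span_singleton'.mpr ⟨w, ?_⟩
  apply FaithfulSMul.algebraMap_injective (𝓞 (maximalRealSubfield K)) (𝓞 K)
  have e1 : algebraMap _ (𝓞 K) ((normHom O x : O.real) : 𝓞 (maximalRealSubfield K)) =
    (x : 𝓞 K) * c x := algebraMap_norm _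
  have e2 : algebraMap _ (𝓞 K) ((normHom O y : O.real) : 𝓞 (maximalRealSubfield K)) =
    (y : 𝓞 K) * c y := algebraMap_norm _
  simp only [map_mul, map_natCast, hw, Subring.subtype_apply, map_sub, e1, e2]
  rw [hx]
  simp only [map_add, map_mul, map_natCast]
  ring

/-- The relative norm `O / f 𝓞_K → O₀ / f 𝓞_{K₀}`. -/
def normMod (O : ConjOrder K) (f : ℕ) :
    O.toSubring ⧸ modIdeal O.toSubring f →* O.real ⧸ modIdeal O.real f where
  toFun := Quotient.lift (fun x => Ideal.Quotient.mk (modIdeal O.real f) (normHom O x))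
    (by
      intro x y h
      refine Ideal.Quotient.eq.mpr (normHom_congr O f x y ?_)
      exact (Submodule.quotientRel_def _).mp h)
  map_one' := by
    change Ideal.Quotient.mk (modIdeal O.real f) (normHom O 1) = 1
    simp
  map_mul' x y := by
    obtain ⟨x, rfl⟩ := Ideal.Quotient.mk_surjective x
    obtain ⟨y, rfl⟩ := Ideal.Quotient.mk_surjective y
    change Ideal.Quotient.mk (modIdeal O.real f) (normHom O (x * y)) =
      Ideal.Quotient.mk (modIdeal O.real f) (normHom O x) *
        Ideal.Quotient.mk (modIdeal O.real f) (normHom O y)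
    simp

lemma normMod_mk (O : ConjOrder K) (f : ℕ) (x : O.toSubring) :
    normMod O f (Ideal.Quotient.mk _ x) = Ideal.Quotient.mk _ (normHom O x) := rfl

lemma le_comap_normMod {A B : ConjOrder K} (h : A.toSubring ≤ B.toSubring) (f : ℕ) :
    unitsSubgroup h f ⊔ rootsSubgroup B.toSubring f ≤
      (unitsSubgroup (ConjOrder.real_mono h) f).comap (Units.map (normMod B f)) := by
  refine sup_le ?_ ?_
  · rintro _ ⟨u, rfl⟩
    refine ⟨Units.map (normMod A f) u, ?_⟩
    ext1
    obtain ⟨v, hv⟩ := Ideal.Quotient.mk_surjective (u : A.toSubring ⧸ modIdeal A.toSubring f)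
    simp only [Units.coe_map, MonoidHom.coe_coe, RingHom.toMonoidHom_eq_coe, ← hv]
    rfl
  · rintro _ ⟨u, hu, rfl⟩
    have hu' : u ∈ CommGroup.torsion B.toSubringˣ := hu
    have hN : normHom B (u : B.toSubring) = 1 := by
      have ht : Units.map (B.toSubring.subtype : B.toSubring →* 𝓞 K) u ∈
          NumberField.Units.torsion K := by
        exact MonoidHom.isOfFinOrder _ hu'
      have h1 := IsCMField.unitsComplexConj_torsion K ⟨_, ht⟩
      apply Subtype.ext
      apply FaithfulSMul.algebraMap_injective (𝓞 (maximalRealSubfield K)) (𝓞 K)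
      refine (algebraMap_norm _).trans ?_
      have h2 := mul_inv_cancel (Units.map (B.toSubring.subtype : B.toSubring →* 𝓞 K) u)
      replace h1 : _ = (Units.map (B.toSubring.subtype : B.toSubring →* 𝓞 K) u)⁻¹ := h1
      rw [← h1] at h2
      have h3 := congrArg Units.val h2
      exact h3
    have : Units.map (normMod B f)
        (Units.map (Ideal.Quotient.mk (modIdeal B.toSubring f)).toMonoidHom u) = 1 := by
      ext1
      change Ideal.Quotient.mk (modIdeal B.real f) (normHom B (u : B.toSubring)) = 1
      rw [hN, map_one]
    rw [Subgroup.mem_comap, this]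
    exact one_mem _

/-- The relative norm map `ψ` from `(B/f𝓞_K)ˣ / ((A/f𝓞_K)ˣ μ_B)` to
`(B₀/f𝓞_{K₀})ˣ / (A₀/f𝓞_{K₀})ˣ`. -/
def relNorm {A B : ConjOrder K} (h : A.toSubring ≤ B.toSubring) (f : ℕ) :
    (B.toSubring ⧸ modIdeal B.toSubring f)ˣ ⧸
        (unitsSubgroup h f ⊔ rootsSubgroup B.toSubring f) →*
      (B.real ⧸ modIdeal B.real f)ˣ ⧸ unitsSubgroup (ConjOrder.real_mono h) f :=
  QuotientGroup.map _ _ (Units.map (normMod B f)) (le_comap_normMod h f)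

end

end QuarticCM

namespace QuarticCM

/-! ### Extending embeddings -/

section Extension

/-! Represent a kernel class by a nonzero `x ∈ O` coprime to `f`. The ideal of the reflex field
generated by `N_Φ(x)` has absolute norm `N(x)²`, and its reflex norm is generated by `y = N(x) x /
x̄`, with `y ȳ = N(x)²` (`prod_reflexType`, `mul_conj_eq`). Since `y` is a quotient of elements of
`O` coprime to `f`, this ideal lies in `S_O` (`principal_mem_reflexKernel`), hence in `S_O'`.

Membership in `S_O'` gives a generator `z` of the reflex norm, now as an ideal of `O'`, with `z z̄ =
y ȳ`. So `ζ = z / y` is integral of absolute value one everywhere, a root of unity by Kronecker's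
theorem (`exists_of_principal_mem_reflexKernel`). Modulo `f` the integer `N(x)` is invertible and `x
x̄` lies in the intersection order, so `ζ x² ≡ N(x)⁻¹ z · x x̄` lies in `O'` (`mul_sq_mem`). Outside
`ℚ(ζ₅)` one has `ζ = ±1` (`sq_eq_one_of_pow_eq_one`), so `ζ x²` lies in both orders and is a unit
modulo `f`, which trivialises the class of `x²` (`sq_mem_of_mul_sq_mem`).

The formula for the reflex norm and the restriction on roots of unity both come from one fact: as
`K` is not biquadratic, some automorphism of the normal closure permutes the four embeddings
cyclically, with its square acting on `K` as complex conjugation (`exists_rotation`). -/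

lemma exists_algEquiv_apply_eq {F L : Type*} [Field F] [CharZero F] [Field L] [CharZero L]
    [Normal ℚ L] (j χ : F →+* L) : ∃ σ : L ≃ₐ[ℚ] L, ∀ x, σ (j x) = χ x := by
  let _ : Algebra F L := j.toAlgebra
  have : IsScalarTower ℚ F L := IsScalarTower.rat
  let e := (χ.toRatAlgHom).liftNormal L
  exact ⟨AlgEquiv.ofBijective e (AlgHom.normal_bijective ℚ L L e),
    fun x => χ.toRatAlgHom.liftNormal_commutes L x⟩

/-- All embeddings of a normal extension have the same image, so they differ by an automorphism. -/
lemma exists_algEquiv_comp_eq {L M : Type*} [Field L] [CharZero L] [Field M] [CharZero M]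
    [Normal ℚ L] (ψ ψ' : L →+* M) : ∃ σ : L ≃ₐ[ℚ] L, ∀ x, ψ' x = ψ (σ x) := by
  let _ : Algebra L M := ψ.toAlgebra
  have : IsScalarTower ℚ L M := IsScalarTower.rat
  let e := (ψ'.toRatAlgHom).restrictNormal L
  exact ⟨AlgEquiv.ofBijective e (AlgHom.normal_bijective ℚ L L e),
    fun x => (ψ'.toRatAlgHom.restrictNormal_commutes L x).symm⟩

lemma exists_ringHom_apply_eq {F L M : Type*} [Field F] [CharZero F] [Field L] [CharZero L]
    [Field M] [CharZero M] [IsAlgClosed M] [Algebra.IsAlgebraic ℚ L] (j : F →+* L) (χ : F →+* M) :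
    ∃ ψ : L →+* M, ∀ x, ψ (j x) = χ x := by
  let _ : Algebra F L := j.toAlgebra
  let _ : Algebra F M := χ.toAlgebra
  have : IsScalarTower ℚ F L := IsScalarTower.rat
  have : Algebra.IsAlgebraic F L := Algebra.IsAlgebraic.tower_top (K := ℚ) F
  exact ⟨(IsAlgClosed.lift : L →ₐ[F] M).toRingHom,
    fun x => (IsAlgClosed.lift : L →ₐ[F] M).commutes x⟩

/-- A field is not the union of the equalizers of `a` with two other homomorphisms. -/
lemma eq_or_eq_of_forall {K L : Type*} [Field K] [Field L] {a b b' : K →+* L}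
    (h : ∀ x, a x = b x ∨ a x = b' x) : a = b ∨ a = b' := by
  by_contra! hne
  obtain ⟨x, hx⟩ := DFunLike.ne_iff.mp hne.1
  obtain ⟨y, hy⟩ := DFunLike.ne_iff.mp hne.2
  have hx' := (h x).resolve_left hx
  have hy' := (h y).resolve_right hy
  rcases h (x + y) with h' | h'
  · rw [map_add, map_add, hy'] at h'
    exact hx (add_right_cancel h')
  · rw [map_add, map_add, hx'] at h'
    exact hy (add_left_cancel h')

/-- Comparing products at `x` and `x + 1` gives equal sums too, so `a x` is a root of `(T - a' x)(T
- b' x)`; `eq_or_eq_of_forall` makes the choice of root uniform in `x`. -/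
lemma eq_or_eq_of_mul_eq {K L : Type*} [Field K] [Field L] {a b a' b' : K →+* L}
    (h : ∀ x, a x * b x = a' x * b' x) : a = a' ∨ a = b' := by
  refine eq_or_eq_of_forall fun x => ?_
  have h1 := h x
  have h2 := h (x + 1)
  simp only [map_add, map_one] at h2
  have h3 : (a x - a' x) * (a x - b' x) = 0 := by linear_combination a x * h2 - (a x + 1) * h1
  rcases mul_eq_zero.mp h3 with h | h
  · exact Or.inl (sub_eq_zero.mp h)
  · exact Or.inr (sub_eq_zero.mp h)

end Extension

/-! ### A cyclic permutation of the four embeddings -/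

section Rotation

variable {K : Type*} [Field K] [NumberField K] [IsCMField K]

variable (K) in
/-- Complex conjugation as a ring homomorphism. -/
noncomputable def conjHom : K →+* K := (IsCMField.complexConj K : K →+* K)

lemma conjHom_apply (x : K) : conjHom K x = IsCMField.complexConj K x := rfl

@[simp] lemma conjHom_conjHom (x : K) : conjHom K (conjHom K x) = x :=
  IsCMField.complexConj_apply_apply K x

lemma exists_conjHom_ne : ∃ x : K, conjHom K x ≠ x := by
  by_contra! h
  exact IsCMField.complexConj_ne_one K (AlgEquiv.ext h)

lemma comp_conjHom_ne {L : Type*} [Field L] (g : K →+* L) : g.comp (conjHom K) ≠ g := by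
  obtain ⟨x, hx⟩ := exists_conjHom_ne (K := K)
  exact fun h => hx (g.injective (RingHom.congr_fun h x))

variable {L : Type*} [Field L] [CharZero L] [Algebra K L]

/-- If the normal closure of a quartic CM-field has no automorphism that permutes the embeddings
cyclically, then the field is biquadratic. -/
lemma exists_rotation [Normal ℚ L] (hbiq : ¬ IsKleinFour (K ≃ₐ[ℚ] K)) {θ : K →+* L}
    (hθ : θ ≠ algebraMap K L) (hθ' : θ ≠ (algebraMap K L).comp (conjHom K))
    (hall : ∀ g : K →+* L, g = algebraMap K L ∨ g = (algebraMap K L).comp (conjHom K) ∨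
      g = θ ∨ g = θ.comp (conjHom K)) :
    ∃ r : L ≃ₐ[ℚ] L, (∀ x, r (algebraMap K L x) = θ x) ∧
      ∀ x, r (θ x) = algebraMap K L (conjHom K x) := by
  have : IsScalarTower ℚ K L := IsScalarTower.rat
  by_contra! h
  -- Of the four possible values of `σ ∘ θ`, injectivity of `σ` excludes `θ` and its conjugate, and
  -- the negated conclusion excludes the conjugate of the inclusion.
  have key : ∀ σ : L ≃ₐ[ℚ] L, (∀ x, σ (algebraMap K L x) = θ x) →
      ∀ x, σ (θ x) = algebraMap K L x := by
    intro σ hσ x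
    rcases hall (((σ : L ≃+* L) : L →+* L).comp θ) with h1 | h1 | h1 | h1
    · exact RingHom.congr_fun h1 x
    · obtain ⟨y, hy⟩ := h σ hσ
      exact absurd (RingHom.congr_fun h1 y) hy
    · refine absurd (RingHom.ext fun y => σ.injective ?_) hθ
      exact (RingHom.congr_fun h1 y).trans (hσ y).symm
    · refine absurd (RingHom.ext fun y => σ.injective ?_) hθ'
      exact (RingHom.congr_fun h1 y).trans (hσ _).symm
  obtain ⟨σ, hσ⟩ := exists_algEquiv_apply_eq (algebraMap K L) θ
  have : Normal K L := Normal.tower_top_of_normal ℚ K L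
  have : IsGalois K L := ⟨⟩
  -- If `τ` fixes `K`, then `σ ∘ τ` also restricts to `θ`; `key` for both maps shows that `τ` fixes
  -- `θ x`. Hence `θ` maps `K` to itself and, by `key`, is an involution there.
  have hfix : ∀ x, ∃ y, algebraMap K L y = θ x := fun x => by
    refine (InfiniteGalois.mem_range_algebraMap_iff_fixed (k := K) (θ x)).mpr fun τ => ?_
    have h1 := key ((τ.restrictScalars ℚ).trans σ) (fun y => by simp [hσ]) x
    exact σ.injective (h1.trans (key σ hσ x).symm)
  choose ρ hρ using hfix
  have hinj := (algebraMap K L).injective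
  have hρρ : ∀ x, ρ (ρ x) = x := fun x => hinj (by rw [hρ, ← hσ, hρ, key σ hσ])
  let e : K ≃ₐ[ℚ] K := AlgEquiv.ofRingEquiv (f :=
    { toFun := ρ
      invFun := ρ
      left_inv := hρρ
      right_inv := hρρ
      map_mul' := fun x y => hinj (by rw [map_mul, hρ, hρ, hρ, map_mul])
      map_add' := fun x y => hinj (by rw [map_add, hρ, hρ, hρ, map_add]) }) (by simp)
  have he : ∀ x, algebraMap K L (e x) = θ x := hρ
  have hee : ∀ x, e (e x) = x := hρρ
  let c : K ≃ₐ[ℚ] K := (IsCMField.complexConj K).restrictScalars ℚ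
  have hc : ∀ x, c x = conjHom K x := fun x => rfl
  have hall' : ∀ g : K ≃ₐ[ℚ] K, g = 1 ∨ g = c ∨ g = e ∨ g = e * c := by
    intro g
    rcases hall ((algebraMap K L).comp ((g : K ≃+* K) : K →+* K)) with h1 | h1 | h1 | h1
    · exact Or.inl (AlgEquiv.ext fun x => hinj (RingHom.congr_fun h1 x))
    · exact Or.inr (Or.inl (AlgEquiv.ext fun x => hinj (RingHom.congr_fun h1 x)))
    · exact Or.inr (Or.inr (Or.inl (AlgEquiv.ext fun x => hinj
        ((RingHom.congr_fun h1 x).trans (he x).symm))))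
    · exact Or.inr (Or.inr (Or.inr (AlgEquiv.ext fun x => hinj
        ((RingHom.congr_fun h1 x).trans (he _).symm))))
  have hcc : c * c = 1 := AlgEquiv.ext fun x => conjHom_conjHom x
  have hee' : e * e = 1 := AlgEquiv.ext hee
  -- Any other value of `c * e` would force `e = c`, `e = 1` or `c = 1`.
  have hce : c * e = e * c := by
    rcases hall' (c * e) with h1 | h1 | h1 | h1
    · exfalso
      have h2 : e = c := by rw [← mul_one c, ← h1, ← mul_assoc, hcc, one_mul]
      exact hθ' (RingHom.ext fun x => by rw [← he, h2]; rfl)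
    · exfalso
      have h2 : e = 1 := mul_left_cancel (h1.trans (mul_one c).symm)
      exact hθ (RingHom.ext fun x => by rw [← he, h2]; rfl)
    · exfalso
      have h2 : c = 1 := mul_right_cancel (h1.trans (one_mul e).symm)
      obtain ⟨x, hx⟩ := exists_conjHom_ne (K := K)
      exact hx (AlgEquiv.congr_fun h2 x)
    · exact h1
  have hc1 : c ≠ 1 := fun h2 => by
    obtain ⟨x, hx⟩ := exists_conjHom_ne (K := K)
    exact hx (AlgEquiv.congr_fun h2 x)
  have he1 : e ≠ 1 := fun h2 => hθ (RingHom.ext fun x => by rw [← he, h2]; rfl)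
  have hec : e ≠ c := fun h2 => hθ' (RingHom.ext fun x => by rw [← he, h2]; rfl)
  have hsq : ∀ g : K ≃ₐ[ℚ] K, g * g = 1 := by
    intro g
    rcases hall' g with rfl | rfl | rfl | rfl
    · exact one_mul 1
    · exact hcc
    · exact hee'
    · rw [mul_assoc, ← mul_assoc c, hce, mul_assoc e, hcc, mul_one, hee']
  classical
  have hcard : Nat.card (K ≃ₐ[ℚ] K) = 4 := by
    have huniv : ({1, c, e, e * c} : Finset (K ≃ₐ[ℚ] K)) = Finset.univ := by
      ext g
      simpa using hall' g
    have h1 : (1 : K ≃ₐ[ℚ] K) ≠ e * c := fun h2 => hec (by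
      rw [← mul_one e, ← hcc, ← mul_assoc, ← h2, one_mul])
    rw [Nat.card_eq_fintype_card, ← Finset.card_univ, ← huniv]
    rw [Finset.card_insert_of_notMem, Finset.card_insert_of_notMem, Finset.card_pair]
    · simpa using hc1
    · simpa [hec.symm] using he1
    · simp [hc1.symm, he1.symm, h1]
  refine hbiq ⟨hcard, ?_⟩
  have hdvd : Monoid.exponent (K ≃ₐ[ℚ] K) ∣ 2 :=
    Monoid.exponent_dvd_of_forall_pow_eq_one fun g => by rw [sq, hsq]
  refine ((Nat.dvd_prime Nat.prime_two).mp hdvd).resolve_left fun h1 => hc1 ?_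
  have := Monoid.pow_exponent_eq_one c
  rwa [h1, pow_one] at this

end Rotation

/-! ### The reflex field inside the normal closure -/

section Reflex

variable {K : Type*} [Field K] [NumberField K] [IsCMField K]

lemma comp_conjHom_comp_conjHom {L : Type*} [Field L] (g : K →+* L) :
    (g.comp (conjHom K)).comp (conjHom K) = g :=
  RingHom.ext fun x => by simp

lemma conjugate_eq_comp_conjHom (φ : K →+* ℂ) :
    ComplexEmbedding.conjugate φ = φ.comp (conjHom K) :=
  RingHom.ext fun x => (IsCMField.complexEmbedding_complexConj K φ x).symm

lemma IsCMType.mem_iff {Φ : Finset (K →+* ℂ)} (hΦ : IsCMType Φ) (φ : K →+* ℂ) :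
    φ.comp (conjHom K) ∈ Φ ↔ φ ∉ Φ := by
  rw [← conjugate_eq_comp_conjHom]
  rcases hΦ φ with h | h <;> tauto

/-- Conjugation maps the type injectively onto its complement, so the type contains two of the four
embeddings. -/
lemma IsCMType.exists_eq_pair (hdeg : Module.finrank ℚ K = 4) {Φ : Finset (K →+* ℂ)}
    (hΦ : IsCMType Φ) : ∃ φ φ' : K →+* ℂ, (∀ g, g ∈ Φ ↔ g = φ ∨ g = φ') ∧ φ' ≠ φ ∧
      φ' ≠ φ.comp (conjHom K) ∧ ∀ g : K →+* ℂ, g = φ ∨ g = φ.comp (conjHom K) ∨ g = φ' ∨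
        g = φ'.comp (conjHom K) := by
  classical
  have hcompl : Φᶜ = Φ.image fun φ => φ.comp (conjHom K) := by
    ext g
    rw [Finset.mem_compl, ← hΦ.mem_iff, Finset.mem_image]
    refine ⟨fun h => ⟨_, h, comp_conjHom_comp_conjHom g⟩, ?_⟩
    rintro ⟨φ, h, rfl⟩
    rwa [comp_conjHom_comp_conjHom]
  have hcard : Φ.card = 2 := by
    have h1 := Finset.card_compl_add_card Φ
    rw [hcompl, Finset.card_image_of_injective, Embeddings.card, hdeg] at h1
    · omega
    · intro a b h
      rw [← comp_conjHom_comp_conjHom a, ← comp_conjHom_comp_conjHom b]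
      exact congrArg (fun g => g.comp (conjHom K)) h
  obtain ⟨φ, φ', hne, rfl⟩ := Finset.card_eq_two.mp hcard
  refine ⟨φ, φ', by simp, hne.symm, fun h => ?_, fun g => ?_⟩
  · have := (hΦ.mem_iff φ).mp (by simp [← h])
    simp at this
  · by_cases hg : g ∈ ({φ, φ'} : Finset (K →+* ℂ))
    · simp only [Finset.mem_insert, Finset.mem_singleton] at hg
      tauto
    · rw [← hΦ.mem_iff, Finset.mem_insert, Finset.mem_singleton] at hg
      rcases hg with hg | hg
      · exact Or.inr (Or.inl (by rw [← hg, comp_conjHom_comp_conjHom]))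
      · exact Or.inr (Or.inr (Or.inr (by rw [← hg, comp_conjHom_comp_conjHom])))

/-- The type norm with values in the reflex field. -/
noncomputable def reflexNorm (Φ : Finset (K →+* ℂ)) (x : K) : reflexField Φ :=
  ⟨typeNorm Φ x, IntermediateField.subset_adjoin _ _ ⟨x, rfl⟩⟩

omit [NumberField K] [IsCMField K] in
lemma coe_reflexNorm (Φ : Finset (K →+* ℂ)) (x : K) :
    (reflexNorm Φ x : ℂ) = typeNorm Φ x := rfl

omit [NumberField K] [IsCMField K] in
-- The type norms generate the reflex field, so embeddings can be compared on them alone.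
lemma reflexField_hom_ext {Φ : Finset (K →+* ℂ)} {M : Type*} [Field M] [CharZero M]
    {χ χ' : reflexField Φ →+* M} (h : ∀ x, χ (reflexNorm Φ x) = χ' (reflexNorm Φ x)) :
    χ = χ' := by
  have : χ.toRatAlgHom = χ'.toRatAlgHom := by
    refine IntermediateField.algHom_ext_of_eq_adjoin (S := reflexField Φ)
      (s := Set.range (typeNorm Φ)) (hS := rfl) (h := ?_)
    rintro _ ⟨x, rfl⟩
    exact h x
  exact RingHom.ext fun x => AlgHom.congr_fun this x

/-- An embedding `ψ` of `L` into `ℂ`, together with the embeddings of `K` and of the reflex field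
into `L` that it induces and an automorphism `r` of `L` that permutes the embeddings of `K`
cyclically. -/
structure ReflexData (Φ : Finset (K →+* ℂ)) (L : Type*) [Field L] [CharZero L]
    [Algebra K L] where
  ψ : L →+* ℂ
  θ : K →+* L
  j : reflexField Φ →+* L
  r : L ≃ₐ[ℚ] L
  mem_iff : ∀ g, g ∈ Φ ↔ g = ψ.comp (algebraMap K L) ∨ g = ψ.comp θ
  ne : θ ≠ algebraMap K L
  ne_conj : θ ≠ (algebraMap K L).comp (conjHom K)
  ψ_j : ∀ z, ψ (j z) = z
  r_algebraMap : ∀ x, r (algebraMap K L x) = θ x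
  r_θ : ∀ x, r (θ x) = algebraMap K L (conjHom K x)
  eq_or : ∀ g : K →+* L, g = algebraMap K L ∨ g = (algebraMap K L).comp (conjHom K) ∨
      g = θ ∨ g = θ.comp (conjHom K)

/-- Extensions to `L` of the two members of the type differ by an automorphism; its restriction to
`K` serves as `θ`, so a single `ψ` describes the whole type. -/
lemma nonempty_reflexData (hdeg : Module.finrank ℚ K = 4) (hbiq : ¬ IsKleinFour (K ≃ₐ[ℚ] K))
    {Φ : Finset (K →+* ℂ)} (hΦ : IsCMType Φ) (L : Type*) [Field L] [CharZero L]
    [Algebra K L] [Normal ℚ L] : Nonempty (ReflexData Φ L) := by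
  obtain ⟨φ, φ', hmem, hne, hne', hall⟩ := hΦ.exists_eq_pair hdeg
  obtain ⟨ψ, hψ⟩ := exists_ringHom_apply_eq (algebraMap K L) φ
  obtain ⟨ψ', hψ'⟩ := exists_ringHom_apply_eq (algebraMap K L) φ'
  obtain ⟨σ, hσ⟩ := exists_algEquiv_comp_eq ψ ψ'
  let θ : K →+* L := ((σ : L ≃+* L) : L →+* L).comp (algebraMap K L)
  have hφ : ψ.comp (algebraMap K L) = φ := RingHom.ext hψ
  have hφ' : ψ.comp θ = φ' := RingHom.ext fun x => (hσ _).symm.trans (hψ' x)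
  have hinj : ∀ {g h : K →+* L}, ψ.comp g = ψ.comp h → g = h := fun H =>
    RingHom.ext fun x => ψ.injective (RingHom.congr_fun H x)
  have h1 : θ ≠ algebraMap K L := fun h => hne (by rw [← hφ, ← hφ', h])
  have h2 : θ ≠ (algebraMap K L).comp (conjHom K) := fun h => hne' (by
    rw [← hφ, ← hφ', h, RingHom.comp_assoc])
  have hall' : ∀ g : K →+* L, g = algebraMap K L ∨ g = (algebraMap K L).comp (conjHom K) ∨
      g = θ ∨ g = θ.comp (conjHom K) := fun g => by
    rcases hall (ψ.comp g) with h | h | h | h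
    · exact Or.inl (hinj (h.trans hφ.symm))
    · exact Or.inr (Or.inl (hinj (h.trans (by rw [← hφ, RingHom.comp_assoc]))))
    · exact Or.inr (Or.inr (Or.inl (hinj (h.trans hφ'.symm))))
    · exact Or.inr (Or.inr (Or.inr (hinj (h.trans (by rw [← hφ', RingHom.comp_assoc])))))
  obtain ⟨r, hr, hr'⟩ := exists_rotation hbiq h1 h2 hall'
  -- Both members of the type take values in `ψ(L)`, so the reflex field can be pulled back along
  -- `ψ`.
  have hle : reflexField Φ ≤ ψ.toRatAlgHom.fieldRange := by
    refine IntermediateField.adjoin_le_iff.mpr ?_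
    rintro _ ⟨x, rfl⟩
    refine prod_mem fun g hg => ?_
    rcases (hmem g).mp hg with rfl | rfl
    · exact ⟨algebraMap K L x, hψ x⟩
    · exact ⟨θ x, RingHom.congr_fun hφ' x⟩
  choose j hj using fun z : reflexField Φ => hle z.2
  have hj' : ∀ z, ψ (j z) = z := hj
  exact ⟨{
    ψ := ψ, θ := θ, r := r
    j :=
      { toFun := j
        map_one' := ψ.injective (by simp [hj'])
        map_zero' := ψ.injective (by simp [hj'])
        map_mul' := fun x y => ψ.injective (by simp [hj'])
        map_add' := fun x y => ψ.injective (by simp [hj']) }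
    mem_iff := by rwa [hφ, hφ']
    ne := h1, ne_conj := h2, ψ_j := hj', r_algebraMap := hr, r_θ := hr', eq_or := hall' }⟩

namespace ReflexData

variable {Φ : Finset (K →+* ℂ)} {L : Type*} [Field L] [CharZero L] [Algebra K L]
  (D : ReflexData Φ L)

lemma ψ_θ_ne : D.ψ.comp (algebraMap K L) ≠ D.ψ.comp D.θ := fun h =>
  D.ne (RingHom.ext fun x => D.ψ.injective (RingHom.congr_fun h x).symm)

lemma typeNorm_eq (x : K) : typeNorm Φ x = D.ψ (algebraMap K L x * D.θ x) := by
  classical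
  have : Φ = {D.ψ.comp (algebraMap K L), D.ψ.comp D.θ} := by
    ext g
    simp [D.mem_iff]
  conv_lhs => rw [typeNorm, this, Finset.prod_pair D.ψ_θ_ne]
  simp

lemma j_reflexNorm (x : K) : D.j (reflexNorm Φ x) = algebraMap K L x * D.θ x :=
  D.ψ.injective (by rw [D.ψ_j, coe_reflexNorm, D.typeNorm_eq])

lemma r_θ_conj (x : K) : D.r (D.θ (conjHom K x)) = algebraMap K L x := by
  rw [D.r_θ, conjHom_conjHom]

end ReflexData

end Reflex

/-! ### Values of type norms and reflex type norms -/

section Values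

variable {K : Type*} [Field K] [NumberField K] [IsCMField K]
variable {Φ : Finset (K →+* ℂ)} {L : Type*} [Field L] [CharZero L] [Algebra K L]

/-- The embeddings of `K` that make up the four conjugates of the CM-type, in cyclic order. -/
noncomputable def ReflexData.emb (D : ReflexData Φ L) : Fin 4 → K →+* L :=
  ![algebraMap K L, D.θ, (algebraMap K L).comp (conjHom K), D.θ.comp (conjHom K)]

/-- The conjugates of the embedding of the reflex field. -/
noncomputable def ReflexData.conj (D : ReflexData Φ L) (k : Fin 4) : reflexField Φ →+* L :=
  ((D.r ^ (k : ℕ) : L ≃ₐ[ℚ] L) : L →+* L).comp D.j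

namespace ReflexData

variable (D : ReflexData Φ L)

lemma emb_injective : Function.Injective D.emb := by
  have h1 : algebraMap K L ≠ D.θ.comp (conjHom K) := fun h =>
    D.ne_conj (by rw [h, comp_conjHom_comp_conjHom])
  have h2 : (algebraMap K L).comp (conjHom K) ≠ D.θ.comp (conjHom K) := fun h =>
    D.ne (by rw [← comp_conjHom_comp_conjHom D.θ, ← h, comp_conjHom_comp_conjHom])
  have h3 := comp_conjHom_ne (algebraMap K L)
  have h4 := comp_conjHom_ne D.θ
  intro a b h
  fin_cases a <;> fin_cases b <;>
    simp [emb, D.ne, D.ne_conj, D.ne.symm, D.ne_conj.symm, h1, h1.symm, h2, h2.symm, h3, h3.symm,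
      h4, h4.symm] at h ⊢

lemma r_emb (k : Fin 4) (x : K) : D.r (D.emb k x) = D.emb (k + 1) x := by
  fin_cases k
  · exact D.r_algebraMap x
  · exact D.r_θ x
  · exact D.r_algebraMap _
  · exact D.r_θ_conj x

lemma exists_emb (g : K →+* L) : ∃ k, g = D.emb k := by
  rcases D.eq_or g with h | h | h | h
  exacts [⟨0, h⟩, ⟨2, h⟩, ⟨1, h⟩, ⟨3, h⟩]

lemma emb_conj (k : Fin 4) (x : K) : D.emb k (conjHom K x) = D.emb (k + 2) x := by
  fin_cases k
  · rfl
  · rfl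
  · exact congrArg (algebraMap K L) (conjHom_conjHom x)
  · exact congrArg D.θ (conjHom_conjHom x)

lemma conj_reflexNorm (k : Fin 4) (x : K) :
    D.conj k (reflexNorm Φ x) = D.emb k x * D.emb (k + 1) x := by
  have key : ∀ n : ℕ, (D.r ^ n) (D.j (reflexNorm Φ x)) =
      D.emb (Fin.ofNat 4 n) x * D.emb (Fin.ofNat 4 n + 1) x := by
    intro n
    induction n with
    | zero => exact D.j_reflexNorm x
    | succ n ih =>
      rw [pow_succ', AlgEquiv.mul_apply, ih, map_mul, r_emb, r_emb]
      have : Fin.ofNat 4 (n + 1) = Fin.ofNat 4 n + 1 := by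
        ext; simp [Fin.val_add]
      rw [this]
  have := key k
  rwa [Fin.ofNat_val_eq_self] at this

/-- Indices modulo 4 that are neither equal nor opposite are adjacent, so the two embeddings form
one of the four rotated types. -/
lemma exists_conj {χ : reflexField Φ →+* L} {a b : Fin 4} (hab : b ≠ a) (hab' : b ≠ a + 2)
    (h : ∀ x, χ (reflexNorm Φ x) = D.emb a x * D.emb b x) :
    (χ = D.conj a ∧ b = a + 1) ∨ (χ = D.conj b ∧ a = b + 1) := by
  have : b = a + 1 ∨ a = b + 1 := by
    clear h
    revert a b
    decide
  rcases this with rfl | rfl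
  · exact Or.inl ⟨reflexField_hom_ext fun x => by rw [h, conj_reflexNorm], rfl⟩
  · exact Or.inr ⟨reflexField_hom_ext fun x => by rw [h, conj_reflexNorm, mul_comm], rfl⟩

lemma conj_injective : Function.Injective D.conj := by
  intro a b h
  have h1 : ∀ x, D.emb a x * D.emb (a + 1) x = D.emb b x * D.emb (b + 1) x := fun x => by
    rw [← conj_reflexNorm, ← conj_reflexNorm, h]
  -- The product determines the unordered pair `{a, a + 1}`, and modulo 4 this pair determines `a`.
  have h2 := (eq_or_eq_of_mul_eq h1).imp (fun e => D.emb_injective e) (fun e => D.emb_injective e)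
  have h3 := (eq_or_eq_of_mul_eq fun x => (mul_comm _ _).trans (h1 x)).imp
    (fun e => D.emb_injective e) (fun e => D.emb_injective e)
  clear h h1
  revert a b
  decide

/-- If `σ ∘ χ = j`, then `χ` is one of the four conjugates, and which one is determined by the
preimages under `σ` of the elements of the type. -/
lemma exists_conj_of_comp_eq {χ : reflexField Φ →+* L} {σ : L ≃ₐ[ℚ] L} (h : ∀ z, σ (D.j z) = χ z)
    {a : Fin 4} (ha : (∀ x, σ (algebraMap K L x) = D.emb a x) ∨ ∀ x, σ (D.θ x) = D.emb a x) :
    χ = D.conj a ∨ χ = D.conj (a + 3) := by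
  obtain ⟨k, hk⟩ := D.exists_emb (((σ : L ≃+* L) : L →+* L).comp (algebraMap K L))
  obtain ⟨l, hl⟩ := D.exists_emb (((σ : L ≃+* L) : L →+* L).comp D.θ)
  have hk' : ∀ x, σ (algebraMap K L x) = D.emb k x := fun x => RingHom.congr_fun hk x
  have hl' : ∀ x, σ (D.θ x) = D.emb l x := fun x => RingHom.congr_fun hl x
  have h1 : l ≠ k := by
    rintro rfl
    exact D.ne (RingHom.ext fun x => σ.injective ((hl' x).trans (hk' x).symm))
  have h2 : l ≠ k + 2 := by
    rintro rfl
    exact D.ne_conj (RingHom.ext fun x => σ.injective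
      ((hl' x).trans ((D.emb_conj k x).symm.trans (hk' _).symm)))
  have h3 := D.exists_conj (χ := χ) h1 h2 fun x => by
    rw [← h, D.j_reflexNorm, map_mul, hk', hl']
  have h4 : a = k ∨ a = l := by
    rcases ha with ha | ha
    · exact Or.inl (D.emb_injective (RingHom.ext fun x => (ha x).symm.trans (hk' x)))
    · exact Or.inr (D.emb_injective (RingHom.ext fun x => (ha x).symm.trans (hl' x)))
  -- The rotated types containing `a` are `{a, a + 1}` and `{a - 1, a}`, with `a - 1` written as `a
  -- + 3`.
  have e : ∀ i : Fin 4, i + 1 + 3 = i := by decide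
  rcases h3 with ⟨rfl, rfl⟩ | ⟨rfl, rfl⟩ <;> rcases h4 with rfl | rfl <;> simp [e]

lemma exists_eq_comp_conj [Normal ℚ L] (χ : reflexField Φ →+* ℂ) :
    ∃ k, χ = D.ψ.comp (D.conj k) := by
  obtain ⟨ψ', hψ'⟩ := exists_ringHom_apply_eq D.j χ
  obtain ⟨σ, hσ⟩ := exists_algEquiv_comp_eq D.ψ ψ'
  obtain ⟨a, ha⟩ := D.exists_emb (((σ : L ≃+* L) : L →+* L).comp (algebraMap K L))
  have hχ : χ = D.ψ.comp (((σ : L ≃+* L) : L →+* L).comp D.j) :=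
    RingHom.ext fun z => (hψ' z).symm.trans (hσ _)
  rcases D.exists_conj_of_comp_eq (χ := ((σ : L ≃+* L) : L →+* L).comp D.j) (fun z => rfl)
    (Or.inl fun x => RingHom.congr_fun ha x) with h | h
  · exact ⟨_, hχ.trans (congrArg _ h)⟩
  · exact ⟨_, hχ.trans (congrArg _ h)⟩

/-- The reflex field is therefore quartic as well, and norms from it are products over `Fin 4`. -/
lemma ψ_comp_conj_bijective [Normal ℚ L] :
    Function.Bijective fun k => D.ψ.comp (D.conj k) := by
  refine ⟨fun a b h => D.conj_injective (RingHom.ext fun z => D.ψ.injective ?_), fun χ => ?_⟩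
  · exact RingHom.congr_fun h z
  · obtain ⟨k, hk⟩ := D.exists_eq_comp_conj χ
    exact ⟨k, hk.symm⟩

lemma algebraMap_norm_eq [Normal ℚ L] (hdeg : Module.finrank ℚ K = 4) (x : K) :
    algebraMap ℚ L (Algebra.norm ℚ x) = ∏ k, D.emb k x := by
  have hbij : Function.Bijective fun k => RingHom.equivRatAlgHom K ℂ (D.ψ.comp (D.emb k)) := by
    rw [Fintype.bijective_iff_injective_and_card]
    refine ⟨fun a b h => D.emb_injective (RingHom.ext fun z => D.ψ.injective ?_), ?_⟩
    · exact RingHom.congr_fun ((RingHom.equivRatAlgHom K ℂ).injective h) z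
    · rw [← Fintype.card_congr (RingHom.equivRatAlgHom K ℂ), Embeddings.card, hdeg,
        Fintype.card_fin]
  apply D.ψ.injective
  have h := Algebra.norm_eq_prod_embeddings ℚ ℂ x
  rw [← hbij.prod_comp] at h
  rw [map_prod, ← RingHom.comp_apply, RingHom.ext_rat (D.ψ.comp (algebraMap ℚ L))
    (algebraMap ℚ ℂ), h]
  rfl

/-- Each embedding of `K` belongs to exactly two of the four rotated types. -/
lemma norm_reflexNorm (D : ReflexData Φ L) [Normal ℚ L] (hdeg : Module.finrank ℚ K = 4) (x : K) :
    Algebra.norm ℚ (reflexNorm Φ x) = Algebra.norm ℚ x ^ 2 := by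
  have hbij : Function.Bijective fun k => RingHom.equivRatAlgHom (reflexField Φ) ℂ (D.ψ.comp (D.conj k)) :=
    (RingHom.equivRatAlgHom (reflexField Φ) ℂ).bijective.comp D.ψ_comp_conj_bijective
  have h := Algebra.norm_eq_prod_embeddings ℚ ℂ (reflexNorm Φ x)
  rw [← hbij.prod_comp] at h
  have h2 : algebraMap ℚ ℂ (Algebra.norm ℚ x) = D.ψ (∏ k, D.emb k x) := by
    rw [← D.algebraMap_norm_eq hdeg, ← RingHom.comp_apply,
      RingHom.ext_rat (D.ψ.comp (algebraMap ℚ L)) (algebraMap ℚ ℂ)]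
  apply (algebraMap ℚ ℂ).injective
  rw [h, map_pow, h2, ← map_pow]
  have : ∀ k, (RingHom.equivRatAlgHom (reflexField Φ) ℂ (D.ψ.comp (D.conj k))) (reflexNorm Φ x) =
      D.ψ (D.emb k x * D.emb (k + 1) x) := fun k => by
    rw [← D.conj_reflexNorm]
    rfl
  simp only [this, ← map_prod, Finset.prod_mul_distrib]
  rw [sq]
  exact congrArg (fun t => D.ψ (_ * t))
    (Equiv.prod_comp (Equiv.addRight (1 : Fin 4)) fun k => D.emb k x)

/-- A type and its conjugate together exhaust the embeddings. This makes the type norm of an integer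
a divisor of its norm. -/
lemma reflexNorm_mul_reflexNorm_conj (D : ReflexData Φ L) [Normal ℚ L] (hdeg : Module.finrank ℚ K = 4) (x : K) :
    reflexNorm Φ x * reflexNorm Φ (conjHom K x) =
      algebraMap ℚ (reflexField Φ) (Algebra.norm ℚ x) := by
  apply D.j.injective
  rw [← RingHom.comp_apply, RingHom.ext_rat (D.j.comp (algebraMap ℚ _)) (algebraMap ℚ L),
    D.algebraMap_norm_eq hdeg, map_mul, D.j_reflexNorm, D.j_reflexNorm, Fin.prod_univ_four]
  simp only [emb, RingHom.comp_apply, Matrix.cons_val]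
  ring

end ReflexData

/-- The reflex type corresponds to the rotated types that contain the inclusion of `K`: those with
indices `{0, 1}` and `{3, 0}`. -/
lemma mem_reflexType_iff (D : ReflexData Φ (NormalClosure K)) [Normal ℚ (NormalClosure K)]
    (χ : reflexField Φ →+* NormalClosure K) :
    χ ∈ reflexType Φ ↔ χ = D.conj 0 ∨ χ = D.conj 3 := by
  rw [reflexType, Set.Finite.mem_toFinset]
  have hcomp : ∀ x : K, D.r (D.emb 3 x) = algebraMap K _ x := D.r_emb 3
  constructor
  · rintro ⟨ψ', hψ', hχ⟩
    obtain ⟨τ, hτ⟩ := exists_algEquiv_comp_eq D.ψ ψ'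
    have h1 : ∀ z, τ.symm (D.j z) = χ z := fun z => by
      rw [AlgEquiv.symm_apply_eq]
      exact D.ψ.injective ((D.ψ_j z).trans ((hχ z).symm.trans (hτ _)))
    refine D.exists_conj_of_comp_eq (a := 0) h1 ?_
    rcases (D.mem_iff _).mp hψ' with h | h
    · refine Or.inl fun x => (AlgEquiv.symm_apply_eq _).mpr (D.ψ.injective ?_)
      exact (RingHom.congr_fun h x).symm.trans (hτ _)
    · refine Or.inr fun x => (AlgEquiv.symm_apply_eq _).mpr (D.ψ.injective ?_)
      exact (RingHom.congr_fun h x).symm.trans (hτ _)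
  · rintro (rfl | rfl)
    · exact ⟨D.ψ, (D.mem_iff _).mpr (Or.inl rfl), D.ψ_j⟩
    · refine ⟨D.ψ.comp (D.r : NormalClosure K →+* NormalClosure K), (D.mem_iff _).mpr (Or.inr ?_), ?_⟩
      · exact RingHom.ext fun x => congrArg D.ψ (D.r_algebraMap x)
      · have : (D.r : NormalClosure K →+* NormalClosure K).comp (D.conj 3) = D.j := by
          refine reflexField_hom_ext fun x => ?_
          rw [RingHom.comp_apply, D.conj_reflexNorm, map_mul, D.j_reflexNorm]
          exact congrArg₂ (· * ·) (D.r_emb 3 x) (D.r_emb 0 x)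
        intro z
        rw [← D.ψ_j z, ← this]
        rfl

/-- The reflex type norm of the type norm of `x` is `N(x) x / x̄`. -/
lemma prod_reflexType (D : ReflexData Φ (NormalClosure K)) [Normal ℚ (NormalClosure K)]
    (hdeg : Module.finrank ℚ K = 4) (x : K) :
    (∏ χ ∈ reflexType Φ, χ (reflexNorm Φ x)) * algebraMap K _ (conjHom K x) =
      algebraMap ℚ _ (Algebra.norm ℚ x) * algebraMap K _ x := by
  classical
  have h : reflexType Φ = {D.conj 0, D.conj 3} := by
    ext χ
    rw [mem_reflexType_iff D]
    simp
  -- The two factors give embeddings 0, 1, 3 and a second 0; multiplying by embedding 2, which is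
  -- `x̄`, completes the norm and leaves one extra `x`.
  rw [h, Finset.prod_pair (D.conj_injective.ne (by decide)), D.conj_reflexNorm,
    D.conj_reflexNorm, D.algebraMap_norm_eq hdeg, Fin.prod_univ_four]
  have h0 : D.emb 0 x = algebraMap K _ x := rfl
  have h2 : D.emb 2 x = algebraMap K _ (conjHom K x) := rfl
  rw [← h0, ← h2]
  simp only [Fin.isValue, zero_add, Fin.reduceAdd]
  ring

end Values

/-! ### Roots of unity in `K` -/

section RootsOfUnity

variable {K : Type*} [Field K] [NumberField K]

/-- Since `φ(5) = 4` is the degree of `K`, the root of unity generates `K`. -/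
lemma isCyclotomicExtension_five (hdeg : Module.finrank ℚ K = 4) {ξ : K}
    (hξ : IsPrimitiveRoot ξ 5) : IsCyclotomicExtension {5} ℚ K := by
  have h1 : IntermediateField.adjoin ℚ {ξ} = ⊤ := by
    rw [Field.primitive_element_iff_minpoly_natDegree_eq,
      ← Polynomial.cyclotomic_eq_minpoly_rat hξ (by norm_num), Polynomial.natDegree_cyclotomic,
      hdeg, Nat.totient_prime Nat.prime_five]
  have h2 : Algebra.adjoin ℚ {ξ} = ⊤ := by
    rw [← IntermediateField.adjoin_simple_toSubalgebra_of_isAlgebraic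
      (Algebra.IsAlgebraic.isAlgebraic ξ), h1, IntermediateField.top_toSubalgebra]
  rw [IsCyclotomicExtension.iff_singleton]
  refine ⟨⟨ξ, hξ⟩, fun x => ?_⟩
  have h3 : x ∈ Algebra.adjoin ℚ {ξ} := h2 ▸ Algebra.mem_top
  refine Algebra.adjoin_mono ?_ h3
  rintro _ rfl
  exact hξ.pow_eq_one

lemma prime_le_of_isPrimitiveRoot {p : ℕ} (hp : p.Prime) {ξ : K} (hξ : IsPrimitiveRoot ξ p) :
    p ≤ Module.finrank ℚ K + 1 := by
  have h := minpoly.natDegree_le (A := ℚ) ξ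
  rw [← Polynomial.cyclotomic_eq_minpoly_rat hξ hp.pos, Polynomial.natDegree_cyclotomic,
    Nat.totient_prime hp] at h
  omega

variable [IsCMField K]

lemma conjHom_mul_self_of_pow_eq_one {ζ : K} {n : ℕ} (hn : n ≠ 0) (h : ζ ^ n = 1) :
    conjHom K ζ * ζ = 1 := by
  obtain ⟨φ⟩ : Nonempty (K →+* ℂ) := inferInstance
  apply φ.injective
  have h1 : ‖φ ζ‖ = 1 := Complex.norm_eq_one_of_pow_eq_one (by rw [← map_pow, h, map_one]) hn
  rw [map_mul, conjHom_apply, IsCMField.complexEmbedding_complexConj, Complex.conj_mul', h1]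
  simp

/-- The only roots of unity in a non-biquadratic quartic CM-field other than `ℚ(ζ₅)` are `±1`. -/
lemma ReflexData.sq_eq_one_of_pow_eq_one {Φ : Finset (K →+* ℂ)} {L : Type*} [Field L]
    [CharZero L] [Algebra K L] (D : ReflexData Φ L) (hdeg : Module.finrank ℚ K = 4)
    (hcyc : ¬ IsCyclotomicExtension {5} ℚ K) {ζ : K} {n : ℕ} (hn : n ≠ 0) (h : ζ ^ n = 1) :
    ζ ^ 2 = 1 := by
  set m := orderOf ζ with hm
  have hm0 : m ≠ 0 := (orderOf_pos_iff.mpr (isOfFinOrder_iff_pow_eq_one.mpr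
    ⟨n, Nat.pos_of_ne_zero hn, h⟩)).ne'
  have hζ : IsPrimitiveRoot ζ m := IsPrimitiveRoot.orderOf ζ
  have : NeZero m := ⟨hm0⟩
  have hζL := hζ.map_of_injective (algebraMap K L).injective
  obtain ⟨k, -, hk⟩ := hζL.eq_pow_of_pow_eq_one
    (show D.r (algebraMap K L ζ) ^ m = 1 by rw [← map_pow, hζL.pow_eq_one, map_one])
  -- The rotation raises `ζ` to the power `k`, while its square is complex conjugation, which
  -- inverts `ζ`; so `k² ≡ -1` modulo `m`.
  have hdvd : m ∣ k * k + 1 := by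
    rw [← hζL.pow_eq_one_iff_dvd, pow_succ, pow_mul, hk, ← map_pow, hk, D.r_algebraMap, D.r_θ,
      ← map_mul, conjHom_mul_self_of_pow_eq_one hn h, map_one]
  -- The degree bounds `p` by 5; 5 is excluded by `hcyc`, and 3 because `-1` is not a square modulo
  -- 3.
  have hprime : ∀ {p : ℕ}, p.Prime → p ∣ m → p = 2 := by
    intro p hp hpm
    obtain ⟨q, hq⟩ := hpm
    have h1 : IsPrimitiveRoot (ζ ^ q) p := hζ.pow (Nat.pos_of_ne_zero hm0) (by rw [hq, mul_comm])
    have h2 := prime_le_of_isPrimitiveRoot hp h1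
    rw [hdeg] at h2
    have h3 : p ≠ 5 := fun h => hcyc (isCyclotomicExtension_five hdeg (h ▸ h1))
    have h4 : p ≠ 3 := by
      rintro rfl
      have h5 : 3 ∣ k * k + 1 := (Dvd.intro q hq.symm).trans hdvd
      have h6 : k % 3 = 0 ∨ k % 3 = 1 ∨ k % 3 = 2 := by omega
      rcases h6 with h6 | h6 | h6 <;> simp [Nat.dvd_iff_mod_eq_zero, Nat.add_mod, Nat.mul_mod, h6] at h5
    have h7 := hp.two_le
    interval_cases p <;> simp_all +decide
  have hpow := Nat.eq_prime_pow_of_unique_prime_dvd hm0 hprime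
  -- Likewise `-1` is not a square modulo 4.
  have h4 : ¬ 4 ∣ m := fun h => by
    have h5 : 4 ∣ k * k + 1 := h.trans hdvd
    have h6 : k % 4 = 0 ∨ k % 4 = 1 ∨ k % 4 = 2 ∨ k % 4 = 3 := by omega
    rcases h6 with h6 | h6 | h6 | h6 <;>
      simp [Nat.dvd_iff_mod_eq_zero, Nat.add_mod, Nat.mul_mod, h6] at h5
  rw [← orderOf_dvd_iff_pow_eq_one, ← hm, hpow]
  rw [hpow] at h4
  have : m.primeFactorsList.length ≤ 1 := by
    by_contra! h
    exact h4 (pow_dvd_pow 2 h)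
  simpa using pow_dvd_pow 2 this

end RootsOfUnity

/-! ### Ideals coprime to `f` -/

section CoprimeIdeals

lemma toPrincipalIdeal_mem_coprimeIdeals {R F : Type*} [CommRing R] [Field F]
    [Algebra R F] [IsFractionRing R F] {f : ℕ} {a : R} {u : Fˣ} (hu : (u : F) = algebraMap R F a)
    (h : IsCoprime a (f : R)) : toPrincipalIdeal R F u ∈ coprimeIdeals R F f := by
  refine Subgroup.subset_closure ⟨Ideal.span {a}, ?_, ?_⟩
  · rw [← Ideal.isCoprime_iff_sup_eq, Ideal.isCoprime_span_singleton_iff]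
    exact h
  · rw [coe_toPrincipalIdeal, FractionalIdeal.coeIdeal_span_singleton, hu]

/-- An ideal coprime to `f` becomes integral after multiplication by some `j ≡ 1 mod f`. -/
lemma exists_mul_mem_of_mem_coprimeIdeals {R F : Type*} [CommRing R] [Field F]
    [Algebra R F] {f : ℕ} {𝔟 : (FractionalIdeal R⁰ F)ˣ} (h : 𝔟 ∈ coprimeIdeals R F f) :
    ∃ t : R, ∀ b ∈ (𝔟 : FractionalIdeal R⁰ F), ∃ i : R,
      algebraMap R F (1 + f * t) * b = algebraMap R F i := by
  -- Treating the ideal and its inverse together lets the closure induction pass through inversion.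
  suffices H : (∃ t : R, ∀ b ∈ (𝔟 : FractionalIdeal R⁰ F), ∃ i : R,
      algebraMap R F (1 + f * t) * b = algebraMap R F i) ∧
      ∃ t : R, ∀ b ∈ ((𝔟⁻¹ : (FractionalIdeal R⁰ F)ˣ) : FractionalIdeal R⁰ F), ∃ i : R,
        algebraMap R F (1 + f * t) * b = algebraMap R F i from H.1
  have hmul : ∀ 𝔟 𝔠 : FractionalIdeal R⁰ F,
      (∃ t : R, ∀ b ∈ 𝔟, ∃ i : R, algebraMap R F (1 + f * t) * b = algebraMap R F i) →
      (∃ t : R, ∀ b ∈ 𝔠, ∃ i : R, algebraMap R F (1 + f * t) * b = algebraMap R F i) →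
      ∃ t : R, ∀ b ∈ 𝔟 * 𝔠, ∃ i : R, algebraMap R F (1 + f * t) * b = algebraMap R F i := by
    rintro 𝔟 𝔠 ⟨s, hs⟩ ⟨t, ht⟩
    refine ⟨s + t + f * (s * t), fun b hb => ?_⟩
    have e : (1 + f * (s + t + f * (s * t)) : R) = (1 + f * s) * (1 + f * t) := by ring
    rw [e]
    refine FractionalIdeal.mul_induction_on hb (fun x hx y hy => ?_) ?_
    · obtain ⟨i, hi⟩ := hs x hx
      obtain ⟨k, hk⟩ := ht y hy
      exact ⟨i * k, by rw [map_mul, mul_mul_mul_comm, hi, hk, map_mul]⟩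
    · rintro x y ⟨i, hi⟩ ⟨k, hk⟩
      exact ⟨i + k, by rw [mul_add, hi, hk, map_add]⟩
  have hone : ∃ t : R, ∀ b ∈ (1 : FractionalIdeal R⁰ F), ∃ i : R,
      algebraMap R F (1 + f * t) * b = algebraMap R F i := by
    refine ⟨0, fun b hb => ?_⟩
    obtain ⟨i, rfl⟩ := (FractionalIdeal.mem_one_iff _).mp hb
    exact ⟨i, by simp⟩
  induction h using Subgroup.closure_induction with
  | mem 𝔟 h =>
    obtain ⟨I, hI, h𝔟⟩ := h
    constructor
    · refine ⟨0, fun b hb => ?_⟩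
      rw [h𝔟] at hb
      obtain ⟨i, -, rfl⟩ := (FractionalIdeal.mem_coeIdeal _).mp hb
      exact ⟨i, by simp⟩
    · have h1 : (1 : R) ∈ I ⊔ Ideal.span {(f : R)} := hI ▸ Submodule.mem_top
      obtain ⟨i, hi, y, hy, hiy⟩ := Submodule.mem_sup.mp h1
      obtain ⟨t, rfl⟩ := Ideal.mem_span_singleton'.mp hy
      -- The element `i = 1 - f t` lies in `I`, so it multiplies the inverse of `I` into `R`.
      refine ⟨-t, fun b hb => ?_⟩
      have h2 : algebraMap R F i * b ∈ (𝔟 * 𝔟⁻¹ : FractionalIdeal R⁰ F) := by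
        refine FractionalIdeal.mul_mem_mul ?_ hb
        rw [h𝔟]
        exact FractionalIdeal.mem_coeIdeal_of_mem _ hi
      have h3 : (𝔟 : FractionalIdeal R⁰ F) * ((𝔟⁻¹ : (FractionalIdeal R⁰ F)ˣ) :
        FractionalIdeal R⁰ F) = 1 := by simp
      rw [h3] at h2
      obtain ⟨k, hk⟩ := (FractionalIdeal.mem_one_iff _).mp h2
      refine ⟨k, ?_⟩
      rw [hk, show (1 + f * -t : R) = i by rw [← hiy]; ring]
  | one => exact ⟨by simpa using hone, by simpa using hone⟩
  | mul 𝔟 𝔠 _ _ h𝔟 h𝔠 =>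
    refine ⟨?_, ?_⟩
    · rw [Units.val_mul]
      exact hmul _ _ h𝔟.1 h𝔠.1
    · rw [mul_inv, Units.val_mul]
      exact hmul _ _ h𝔟.2 h𝔠.2
  | inv 𝔟 _ h => exact ⟨h.2, by rw [inv_inv]; exact h.1⟩

/-- Coefficients from `R` become integral in `L` and are absorbed by `𝓞 L`; hence this applies to
nonmaximal orders too. -/
lemma span_image_eq_span_singleton {R F L : Type*} [CommRing R] [Field F] [Algebra R F]
    [Field L] (h : F →+* L) (hR : ∀ r : R, IsIntegral ℤ (algebraMap R F r))
    {M : Submodule R F} {y : F} (hM : M = Submodule.span R {y}) :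
    Submodule.span (𝓞 L) (h '' (M : Set F)) = Submodule.span (𝓞 L) {h y} := by
  refine le_antisymm (Submodule.span_le.mpr ?_) (Submodule.span_mono ?_)
  · rintro _ ⟨z, hz, rfl⟩
    rw [hM] at hz
    obtain ⟨r, rfl⟩ := Submodule.mem_span_singleton.mp hz
    refine Submodule.mem_span_singleton.mpr
      ⟨⟨h (algebraMap R F r), map_isIntegral_int h (hR r)⟩, ?_⟩
    rw [Algebra.smul_def, map_mul]
    rfl
  · rintro _ rfl
    exact ⟨y, hM ▸ Submodule.mem_span_singleton_self y, rfl⟩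

/-- The norm of an algebraic integer coprime to `f` is coprime to `f`. -/
lemma isCoprime_norm {K : Type*} [Field K] [NumberField K] {x : 𝓞 K} {f : ℕ}
    (h : IsCoprime x (f : 𝓞 K)) : IsCoprime (Algebra.norm ℤ x) (f : ℤ) := by
  classical
  obtain ⟨v, t, hvt⟩ := h
  let b := RingOfIntegers.basis K
  -- As `v x ≡ 1` modulo `f`, its multiplication matrix reduces to the identity.
  have h1 : ((Algebra.norm ℤ (v * x) : ℤ) : ZMod f) = 1 := by
    have h2 : v * x = 1 - (f : 𝓞 K) * t := by rw [← hvt]; ring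
    rw [h2, Algebra.norm_eq_matrix_det b, ← eq_intCast (Int.castRingHom (ZMod f)), RingHom.map_det, map_sub,
      map_mul, map_natCast, map_sub, map_mul, map_natCast, map_one, map_one]
    have h3 : ((f : ℕ) : Matrix (Module.Free.ChooseBasisIndex ℤ (𝓞 K))
        (Module.Free.ChooseBasisIndex ℤ (𝓞 K)) (ZMod f)) = 0 := by
      ext i j
      simp [Matrix.natCast_apply]
    rw [h3, zero_mul, sub_zero, Matrix.det_one]
  have h4 : (f : ℤ) ∣ 1 - Algebra.norm ℤ (v * x) := by
    rw [← ZMod.intCast_zmod_eq_zero_iff_dvd]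
    rw [Int.cast_sub, Int.cast_one, h1, sub_self]
  obtain ⟨k, hk⟩ := h4
  rw [map_mul] at hk
  exact ⟨Algebra.norm ℤ v, k, by linarith⟩

end CoprimeIdeals

/-! ### Orders stable under complex conjugation -/

section Orders

variable {K : Type*} [Field K] [NumberField K] [IsCMField K]

namespace ConjOrder

lemma index_ne_zero (O : ConjOrder K) : O.index ≠ 0 := O.finiteIndex.index_ne_zero

lemma index_mul_mem (O : ConjOrder K) (w : 𝓞 K) : (O.index : 𝓞 K) * w ∈ O.toSubring := by
  rw [← nsmul_eq_mul]
  exact O.toSubring.toAddSubgroup.nsmul_index_mem w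

lemma isIntegral_algebraMap (O : ConjOrder K) (r : O.toSubring) :
    IsIntegral ℤ (algebraMap O.toSubring K r) :=
  RingOfIntegers.isIntegral_coe (r : 𝓞 K)

instance isFractionRing (O : ConjOrder K) : IsFractionRing O.toSubring K := by
  have : FaithfulSMul O.toSubring K := by
    rw [faithfulSMul_iff_algebraMap_injective]
    exact RingOfIntegers.coe_injective.comp Subtype.val_injective
  refine IsFractionRing.of_field _ _ fun z => ?_
  obtain ⟨a, b, hb, rfl⟩ := IsFractionRing.div_surjective (A := 𝓞 K) z
  refine ⟨⟨_, O.index_mul_mem a⟩, ⟨_, O.index_mul_mem b⟩, ?_⟩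
  change _ = algebraMap (𝓞 K) K (O.index * a) / algebraMap (𝓞 K) K (O.index * b)
  rw [map_mul, map_mul, mul_div_mul_left]
  simpa using O.index_ne_zero

end ConjOrder

lemma conjIdeal_eq_span (O : ConjOrder K) {𝔞 : FractionalIdeal O.toSubring⁰ K} {y : K}
    (h : (𝔞 : Submodule O.toSubring K) = Submodule.span O.toSubring {y}) :
    conjIdeal O 𝔞 = Submodule.span O.toSubring {IsCMField.complexConj K y} := by
  refine le_antisymm (Submodule.span_le.mpr ?_) (Submodule.span_mono ?_)
  · rintro _ ⟨z, hz, rfl⟩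
    have hz' : z ∈ (𝔞 : Submodule O.toSubring K) := hz
    rw [h] at hz'
    obtain ⟨r, rfl⟩ := Submodule.mem_span_singleton.mp hz'
    refine Submodule.mem_span_singleton.mpr ⟨⟨_, O.conj_mem r r.2⟩, ?_⟩
    rw [Algebra.smul_def, Algebra.smul_def, map_mul]
    rfl
  · rintro _ rfl
    have : y ∈ (𝔞 : Submodule O.toSubring K) := h ▸ Submodule.mem_span_singleton_self y
    exact ⟨y, this, rfl⟩

end Orders

/-! ### Principal ideals generated by type norms -/

section Reflex

variable {K : Type*} [Field K] [NumberField K] [IsCMField K] {Φ : Finset (K →+* ℂ)}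

omit [NumberField K] [IsCMField K] in
lemma isIntegral_reflexNorm (Φ : Finset (K →+* ℂ)) (x : 𝓞 K) :
    IsIntegral ℤ (reflexNorm Φ (x : K)) := by
  rw [← isIntegral_algebraMap_iff (algebraMap (reflexField Φ) ℂ).injective]
  exact IsIntegral.prod _ fun φ _ => map_isIntegral_int φ x.isIntegral_coe

instance normal_normalClosure : Normal ℚ (NormalClosure K) := by
  have : Normal ℚ (AlgebraicClosure K) :=
    have : IsAlgClosure ℚ (AlgebraicClosure K) :=
      ⟨inferInstance, Algebra.IsAlgebraic.trans ℚ K (AlgebraicClosure K)⟩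
    IsAlgClosure.normal ℚ (AlgebraicClosure K)
  exact normalClosure.normal ℚ K (AlgebraicClosure K)

namespace ReflexData

variable (D : ReflexData Φ (NormalClosure K))

lemma reflexNorm_ne_zero (D : ReflexData Φ (NormalClosure K)) (hdeg : Module.finrank ℚ K = 4)
    {x : K} (hx : x ≠ 0) : reflexNorm Φ x ≠ 0 := by
  intro h
  have h1 := D.norm_reflexNorm hdeg x
  rw [h, Algebra.norm_zero] at h1
  exact hx (Algebra.norm_eq_zero_iff.mp (pow_eq_zero_iff two_ne_zero |>.mp h1.symm))

/-- The principal ideal generated by the type norm of `x`. -/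
noncomputable def principal (D : ReflexData Φ (NormalClosure K)) (hdeg : Module.finrank ℚ K = 4)
    {x : K} (hx : x ≠ 0) : (FractionalIdeal (𝓞 (reflexField Φ))⁰ (reflexField Φ))ˣ :=
  toPrincipalIdeal _ _ (Units.mk0 (reflexNorm Φ x) (D.reflexNorm_ne_zero hdeg hx))

lemma coe_principal (hdeg : Module.finrank ℚ K = 4) {x : K} (hx : x ≠ 0) :
    (D.principal hdeg hx : FractionalIdeal (𝓞 (reflexField Φ))⁰ (reflexField Φ)) =
      FractionalIdeal.spanSingleton _ (reflexNorm Φ x) := by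
  rw [principal, coe_toPrincipalIdeal, Units.val_mk0]

lemma absNorm_principal (hdeg : Module.finrank ℚ K = 4) {x : K} (hx : x ≠ 0) :
    FractionalIdeal.absNorm
      (D.principal hdeg hx : FractionalIdeal (𝓞 (reflexField Φ))⁰ (reflexField Φ)) =
      Algebra.norm ℚ x ^ 2 := by
  rw [coe_principal, FractionalIdeal.absNorm_span_singleton, D.norm_reflexNorm hdeg,
    abs_of_nonneg (sq_nonneg _)]

/-- The type norm divides the integer `N(x)`, which is coprime to `f`. -/
lemma principal_mem (hdeg : Module.finrank ℚ K = 4) {x : 𝓞 K} (hx : (x : K) ≠ 0) {f : ℕ}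
    (h : IsCoprime x (f : 𝓞 K)) :
    D.principal hdeg hx ∈ coprimeIdeals (𝓞 (reflexField Φ)) (reflexField Φ) f := by
  let w : 𝓞 (reflexField Φ) := ⟨_, isIntegral_reflexNorm Φ x⟩
  let w' : 𝓞 (reflexField Φ) :=
    ⟨_, isIntegral_reflexNorm Φ (IsCMField.ringOfIntegersComplexConj K x)⟩
  refine toPrincipalIdeal_mem_coprimeIdeals (a := w) rfl ?_
  have h1 : w * w' = ((Algebra.norm ℤ x : ℤ) : 𝓞 (reflexField Φ)) := by
    apply RingOfIntegers.ext
    refine (D.reflexNorm_mul_reflexNorm_conj hdeg x).trans ?_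
    rw [← Algebra.coe_norm_int]
    simp
  refine IsCoprime.of_mul_left_left (y := w') ?_
  rw [h1]
  simpa using (isCoprime_norm h).map (Int.castRingHom (𝓞 (reflexField Φ)))

lemma prod_span_principal (hdeg : Module.finrank ℚ K = 4) {x : K} (hx : x ≠ 0) :
    ∏ χ ∈ reflexType Φ, Submodule.span (𝓞 (NormalClosure K))
      (χ '' ((D.principal hdeg hx : FractionalIdeal (𝓞 (reflexField Φ))⁰ (reflexField Φ)) :
        Set (reflexField Φ))) =
      Submodule.span (𝓞 (NormalClosure K)) {algebraMap K (NormalClosure K)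
        (algebraMap ℚ K (Algebra.norm ℚ x) * x / conjHom K x)} := by
  have h1 : ∀ χ ∈ reflexType Φ, Submodule.span (𝓞 (NormalClosure K))
      (χ '' ((D.principal hdeg hx : FractionalIdeal (𝓞 (reflexField Φ))⁰ (reflexField Φ)) :
        Set (reflexField Φ))) = Submodule.span (𝓞 (NormalClosure K)) {χ (reflexNorm Φ x)} := by
    intro χ _
    refine span_image_eq_span_singleton χ (fun r => r.isIntegral_coe) ?_
    rw [D.coe_principal, FractionalIdeal.coe_spanSingleton]
  rw [Finset.prod_congr rfl h1, Submodule.prod_span_singleton]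
  have h2 : algebraMap K (NormalClosure K) (conjHom K x) ≠ 0 := by
    simpa using hx
  have h3 := prod_reflexType D hdeg x
  congr 2
  rw [map_div₀, eq_div_iff h2, h3, map_mul, ← IsScalarTower.algebraMap_apply]

/-- The factor `x / x̄` cancels against its conjugate. The result matches `absNorm_principal`, as
the second component of the pair requires. -/
lemma mul_conj_eq {x : K} (hx : x ≠ 0) :
    (algebraMap ℚ K (Algebra.norm ℚ x) * x / conjHom K x) *
      conjHom K (algebraMap ℚ K (Algebra.norm ℚ x) * x / conjHom K x) =
      algebraMap ℚ K (Algebra.norm ℚ x ^ 2) := by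
  have h1 : conjHom K x ≠ 0 := by simpa using hx
  have h2 : conjHom K (algebraMap ℚ K (Algebra.norm ℚ x)) = algebraMap ℚ K (Algebra.norm ℚ x) := by
    rw [← RingHom.comp_apply, RingHom.ext_rat ((conjHom K).comp (algebraMap ℚ K))]
  rw [map_div₀, map_mul, conjHom_conjHom, h2, map_pow]
  field_simp

/-- The generator `N(x) x / x̄` is built from three elements of `O` coprime to `f`, because `O` is
stable under conjugation. It thus generates an ideal of `O` coprime to `f` and itself witnesses
principality of the pair. -/
lemma principal_mem_reflexKernel (hdeg : Module.finrank ℚ K = 4) (O : ConjOrder K)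
    {x : O.toSubring} (hx : ((x : 𝓞 K) : K) ≠ 0) {f : ℕ} (h : IsCoprime x (f : O.toSubring)) :
    (⟨D.principal hdeg hx, D.principal_mem hdeg hx (by
      simpa using h.map O.toSubring.subtype)⟩ : coprimeIdeals _ _ f) ∈ reflexKernel Φ O f := by
  have hx' : IsCoprime (x : 𝓞 K) (f : 𝓞 K) := by simpa using h.map O.toSubring.subtype
  set X : K := ((x : 𝓞 K) : K) with hX
  have hbar : conjHom K X ≠ 0 := by simpa using hx
  have hN : algebraMap ℚ K (Algebra.norm ℚ X) ≠ 0 := by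
    simpa [Algebra.norm_eq_zero_iff] using hx
  let u : Kˣ := Units.mk0 X hx
  let v : Kˣ := Units.mk0 _ hbar
  let n : Kˣ := Units.mk0 _ hN
  have hy : ((n * u * v⁻¹ : Kˣ) : K) = algebraMap ℚ K (Algebra.norm ℚ X) * X / conjHom K X := by
    rw [div_eq_mul_inv, Units.val_mul, Units.val_mul, Units.val_inv_eq_inv_val]
    rfl
  let N : (maximalRealSubfield K)ˣ := Units.mk0 (algebraMap ℚ _ (Algebra.norm ℚ X ^ 2)) (by
    simpa [Algebra.norm_eq_zero_iff] using hx)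
  have hN' : ((N : maximalRealSubfield K) : K) = algebraMap ℚ K (Algebra.norm ℚ X ^ 2) :=
    (IsScalarTower.algebraMap_apply ℚ (maximalRealSubfield K) K _).symm
  have hspan : ((toPrincipalIdeal O.toSubring K (n * u * v⁻¹) :
      FractionalIdeal O.toSubring⁰ K) : Submodule O.toSubring K) =
      Submodule.span O.toSubring
        {algebraMap ℚ K (Algebra.norm ℚ X) * X / conjHom K X} := by
    rw [coe_toPrincipalIdeal, FractionalIdeal.coe_spanSingleton, hy]
  have hmem : toPrincipalIdeal O.toSubring K (n * u * v⁻¹) ∈ coprimeIdeals O.toSubring K f := by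
    rw [map_mul, map_mul, map_inv]
    refine mul_mem (mul_mem ?_ ?_) (inv_mem ?_)
    · refine toPrincipalIdeal_mem_coprimeIdeals (a := ((Algebra.norm ℤ (x : 𝓞 K) : ℤ) :
        O.toSubring)) ?_ ?_
      · change algebraMap ℚ K (Algebra.norm ℚ X) = _
        rw [hX, ← Algebra.coe_norm_int]
        simp
      · simpa using (isCoprime_norm hx').map (Int.castRingHom O.toSubring)
    · exact toPrincipalIdeal_mem_coprimeIdeals (a := x) rfl h
    · refine toPrincipalIdeal_mem_coprimeIdeals (a := ⟨_, O.conj_mem x x.2⟩) rfl ?_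
      let τ : O.toSubring →+* O.toSubring :=
        ((IsCMField.ringOfIntegersComplexConj K : 𝓞 K →+* 𝓞 K).comp O.toSubring.subtype).codRestrict
          O.toSubring fun z => O.conj_mem z z.2
      have h' := h.map τ
      rw [map_natCast] at h'
      exact h'
  have hpair : (toPrincipalIdeal O.toSubring K (n * u * v⁻¹), N) ∈ pairGroup O f := by
    refine ⟨hmem, fun φ => ?_, ?_⟩
    · change 0 < φ (algebraMap ℚ _ (Algebra.norm ℚ X ^ 2))
      rw [map_pow, map_pow]
      refine sq_pos_iff.mpr ?_
      simpa [Algebra.norm_eq_zero_iff] using hx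
    · rw [conjIdeal_eq_span O hspan, hspan, Submodule.span_mul_span, Set.singleton_mul_singleton,
        hN', ← mul_conj_eq hx]
      rfl
  refine ⟨⟨_, hpair⟩, ?_, ?_, ?_⟩
  · rw [IsReflexNorm]
    refine Eq.trans ?_ (D.prod_span_principal hdeg hx).symm
    exact span_image_eq_span_singleton _ O.isIntegral_algebraMap hspan
  · change algebraMap ℚ _ (Algebra.norm ℚ X ^ 2) = algebraMap ℚ _ (FractionalIdeal.absNorm _)
    rw [D.absNorm_principal]
  · rw [QuotientGroup.eq_one_iff]
    refine ⟨n * u * v⁻¹, ?_, ?_⟩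
    · rw [hy]
      exact hspan
    · rw [hy]
      exact hN'.trans (mul_conj_eq hx).symm

/-- Here `x` need not lie in `O`, so the generator `z` supplied by the kernel may differ from `y =
N(x) x / x̄`. Both generate the same ideal of `𝓞 L` and have the same product with their conjugate,
so Kronecker's theorem makes `ζ = z / y` a root of unity. Coprimality of `zO` to `f` then gives `(1
+ f t) z = i` in `O`; the final equation is this one multiplied by `x̄`. -/
lemma exists_of_principal_mem_reflexKernel (hdeg : Module.finrank ℚ K = 4) (O : ConjOrder K)
    {x : 𝓞 K} (hx : (x : K) ≠ 0) {f : ℕ} {h : D.principal hdeg hx ∈ coprimeIdeals _ _ f}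
    (hS : (⟨_, h⟩ : coprimeIdeals _ _ f) ∈ reflexKernel Φ O f) :
    ∃ ζ : 𝓞 K, (∃ m ≠ 0, (ζ : K) ^ m = 1) ∧ ∃ t ∈ O.toSubring, ∃ i ∈ O.toSubring,
      (1 + f * t) * (ζ * Algebra.norm ℤ x * x) = i * IsCMField.ringOfIntegersComplexConj K x := by
  obtain ⟨p, hp1, hp2, hp3⟩ := hS
  rw [QuotientGroup.eq_one_iff] at hp3
  obtain ⟨z, hz1, hz2⟩ := hp3
  set y : K := algebraMap ℚ K (Algebra.norm ℚ (x : K)) * x / conjHom K x with hy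
  have hbar : conjHom K (x : K) ≠ 0 := by simpa using hx
  have hN : algebraMap ℚ K (Algebra.norm ℚ (x : K)) ≠ 0 := by
    simpa [Algebra.norm_eq_zero_iff] using hx
  have hy0 : y ≠ 0 := div_ne_zero (mul_ne_zero hN hx) hbar
  have hzy : (z : K) * conjHom K z = y * conjHom K y := by
    rw [conjHom_apply, ← hz2, hp2, D.absNorm_principal, mul_conj_eq hx]
    exact (IsScalarTower.algebraMap_apply ℚ (maximalRealSubfield K) K _).symm
  replace hp1 := (span_image_eq_span_singleton _ O.isIntegral_algebraMap hz1).symm.trans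
    (hp1.trans (D.prod_span_principal hdeg hx))
  have hint : IsIntegral ℤ ((z : K) / y) := by
    have h1 : algebraMap K (NormalClosure K) z ∈
        Submodule.span (𝓞 (NormalClosure K)) {algebraMap K (NormalClosure K) y} :=
      hp1 ▸ Submodule.mem_span_singleton_self _
    obtain ⟨a, ha⟩ := Submodule.mem_span_singleton.mp h1
    have : IsScalarTower ℤ K (NormalClosure K) :=
      IsScalarTower.of_algebraMap_eq' (RingHom.ext_int _ _)
    rw [← isIntegral_algebraMap_iff (algebraMap K (NormalClosure K)).injective, map_div₀, ← ha,
      Algebra.smul_def, mul_div_cancel_right₀ _ (by simpa using hy0)]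
    exact a.isIntegral_coe
  have hnorm : ∀ φ : K →+* ℂ, ‖φ ((z : K) / y)‖ = 1 := by
    intro φ
    have h1 : (z : K) / y * conjHom K ((z : K) / y) = 1 := by
      rw [map_div₀, div_mul_div_comm, hzy, div_self (mul_ne_zero hy0 (by simpa using hy0))]
    have h2 := congrArg φ h1
    rw [map_mul, conjHom_apply, IsCMField.complexEmbedding_complexConj, Complex.mul_conj',
      map_one] at h2
    have h3 : ‖φ ((z : K) / y)‖ ^ 2 = 1 := by exact_mod_cast h2
    exact (pow_eq_one_iff_of_nonneg (norm_nonneg _) two_ne_zero).mp h3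
  obtain ⟨m, hm, hpow⟩ := Embeddings.pow_eq_one_of_norm_eq_one K ℂ hint hnorm
  obtain ⟨ζ, hζ⟩ : ∃ ζ : 𝓞 K, algebraMap (𝓞 K) K ζ = (z : K) / y := ⟨⟨_, hint⟩, rfl⟩
  rw [← hζ] at hpow
  refine ⟨ζ, ⟨m, hm.ne', hpow⟩, ?_⟩
  obtain ⟨t, ht⟩ := exists_mul_mem_of_mem_coprimeIdeals p.2.1
  have hzmem : (z : K) ∈ ((p.1.1 : FractionalIdeal O.toSubring⁰ K) : Submodule O.toSubring K) :=
    hz1 ▸ Submodule.mem_span_singleton_self _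
  obtain ⟨i, hi⟩ := ht z hzmem
  refine ⟨t, t.2, i, i.2, RingOfIntegers.ext ?_⟩
  have hi' : (1 + (f : K) * algebraMap (𝓞 K) K t) * (z : K) = algebraMap (𝓞 K) K i := by
    refine Eq.trans ?_ hi
    congr 1
  have hn : algebraMap ℚ K (Algebra.norm ℚ (x : K)) = ((Algebra.norm ℤ x : ℤ) : K) := by
    rw [← Algebra.coe_norm_int]
    simp
  have hyx : y * conjHom K (x : K) = ((Algebra.norm ℤ x : ℤ) : K) * x := by
    rw [hy, div_mul_cancel₀ _ hbar, hn]
  have e : algebraMap (𝓞 K) K (IsCMField.ringOfIntegersComplexConj K x) = conjHom K (x : K) := rfl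
  simp only [map_mul, map_add, map_one, map_natCast, map_intCast, e]
  rw [← hi', hζ, mul_assoc ((z : K) / y), ← hyx]
  field_simp

end ReflexData

end Reflex

/-! ### Passing between the two orders modulo `f` -/

section Main

variable {K : Type*} [Field K] [NumberField K] [IsCMField K]

lemma mem_modIdeal_iff {F : Type*} [Field F] {R : Subring (𝓞 F)} {f : ℕ} {x : R} :
    x ∈ modIdeal R f ↔ ∃ s : 𝓞 F, (x : 𝓞 F) = f * s := by
  rw [modIdeal, Ideal.mem_comap, Ideal.mem_span_singleton]
  rfl

/-- The quotient is by the trace of `f 𝓞_F`, which may exceed `f R`. From `v x = 1 + f w`,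
multiplying by `1 - f w ∈ R` gives `1 - f (f w²)`, and `f w² ∈ R`. -/
lemma isCoprime_of_isUnit_mk {F : Type*} [Field F] {R : Subring (𝓞 F)} {f : ℕ}
    (hR : ∀ w : 𝓞 F, f * w ∈ R) {x : R} (h : IsUnit (Ideal.Quotient.mk (modIdeal R f) x)) :
    IsCoprime x (f : R) := by
  obtain ⟨V, hV⟩ := h.exists_left_inv
  obtain ⟨v, rfl⟩ := Ideal.Quotient.mk_surjective V
  rw [← map_mul, ← map_one (Ideal.Quotient.mk (modIdeal R f)), Ideal.Quotient.eq,
    mem_modIdeal_iff] at hV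
  obtain ⟨w, hw⟩ := hV
  refine ⟨v * (1 - ⟨_, hR w⟩), ⟨_, hR (w * w)⟩, Subtype.ext ?_⟩
  push_cast at hw ⊢
  linear_combination (1 - (f : 𝓞 F) * w) * hw

lemma exists_ne_zero_lift {F : Type*} [Field F] [CharZero F] {R : Subring (𝓞 F)} {f : ℕ}
    (hf : f ≠ 0) (u : R ⧸ modIdeal R f) :
    ∃ x : R, x ≠ 0 ∧ Ideal.Quotient.mk (modIdeal R f) x = u := by
  obtain ⟨x, rfl⟩ := Ideal.Quotient.mk_surjective u
  by_cases hx : x = 0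
  -- The zero class can be a unit when `f = 1`; `f` itself is then a nonzero representative.
  · refine ⟨(f : R), fun h => hf ?_, ?_⟩
    · have := congrArg Subtype.val h
      simpa using this
    · rw [Ideal.Quotient.eq, mem_modIdeal_iff]
      exact ⟨1, by simp [hx]⟩
  · exact ⟨x, hx, rfl⟩

/-- Multiply the relation by `x` and by an inverse `a` of `n` modulo `f`: then `ζ x² ≡ a i x x̄`
modulo `f 𝓞_K`, and both the right side and `f 𝓞_K` lie in `O`. -/
lemma ConjOrder.mul_sq_mem (O : ConjOrder K) {f : ℕ} (hf : ∀ w : 𝓞 K, f * w ∈ O.toSubring)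
    {x ζ t i : 𝓞 K} {n : ℤ} (hn : IsCoprime n (f : ℤ)) (hi : i ∈ O.toSubring)
    (hx : x * IsCMField.ringOfIntegersComplexConj K x ∈ O.toSubring)
    (h : (1 + f * t) * (ζ * n * x) = i * IsCMField.ringOfIntegersComplexConj K x) :
    ζ * x ^ 2 ∈ O.toSubring := by
  obtain ⟨a, b, hab⟩ := hn
  have hab' : (a : 𝓞 K) * n + b * f = 1 := by exact_mod_cast congrArg (Int.cast (R := 𝓞 K)) hab
  have h1 := O.toSubring.mul_mem (O.toSubring.mul_mem (intCast_mem O.toSubring a) hi) hx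
  have h2 := O.toSubring.add_mem h1 (hf ((b - t + b * f * t) * (ζ * x ^ 2)))
  convert h2 using 1
  linear_combination (-(ζ * x ^ 2) * (1 + f * t)) * hab' + a * x * h

/-- If `x x̄` is a unit modulo `f` in `A₀` and `ζ x²` lies in `A` for some root of unity `ζ` of
`B`, then the square of the class of `x` is trivial. -/
lemma sq_mem_of_mul_sq_mem {A B : ConjOrder K} (h : A.toSubring ≤ B.toSubring) {f : ℕ}
    {u : (B.toSubring ⧸ modIdeal B.toSubring f)ˣ} {x : B.toSubring}
    (hu : Ideal.Quotient.mk _ x = (u : B.toSubring ⧸ modIdeal B.toSubring f))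
    {b : A.real} {s : 𝓞 K}
    (hb : (x : 𝓞 K) * IsCMField.ringOfIntegersComplexConj K x *
      algebraMap (𝓞 (maximalRealSubfield K)) (𝓞 K) b = 1 + f * s)
    {ζ : B.toSubring} {m : ℕ} (hm : m ≠ 0) (hζ : ζ ^ m = 1)
    (hA : (ζ : 𝓞 K) * (x : 𝓞 K) ^ 2 ∈ A.toSubring) :
    u ^ 2 ∈ unitsSubgroup h f ⊔ rootsSubgroup B.toSubring f := by
  set c := IsCMField.ringOfIntegersComplexConj K with hc
  have hζ' : c (ζ : 𝓞 K) * ζ = 1 := by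
    apply RingOfIntegers.ext
    have h1 : (((ζ : 𝓞 K) : K)) ^ m = 1 := by
      have := congrArg (fun z : B.toSubring => ((z : 𝓞 K) : K)) hζ
      simpa using this
    refine (map_mul (algebraMap (𝓞 K) K) _ _).trans ?_
    exact (conjHom_mul_self_of_pow_eq_one hm h1).trans (map_one (algebraMap (𝓞 K) K)).symm
  let y : A.toSubring := ⟨_, hA⟩
  -- Since `ζ ζ̄ = 1`, `y ȳ = (x x̄)²`, and `b` inverts `x x̄` modulo `f`; so `ȳ b²` inverts `y`.
  let y' : A.toSubring := ⟨c y, A.conj_mem y y.2⟩ * ⟨_, b.2⟩ ^ 2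
  have hyy : Ideal.Quotient.mk (modIdeal A.toSubring f) y *
      Ideal.Quotient.mk (modIdeal A.toSubring f) y' = 1 := by
    rw [← map_mul, ← map_one (Ideal.Quotient.mk (modIdeal A.toSubring f)), Ideal.Quotient.eq,
      mem_modIdeal_iff]
    refine ⟨2 * s + f * s ^ 2, ?_⟩
    change (ζ : 𝓞 K) * (x : 𝓞 K) ^ 2 * (c ((ζ : 𝓞 K) * (x : 𝓞 K) ^ 2) *
      (algebraMap (𝓞 (maximalRealSubfield K)) (𝓞 K) b) ^ 2) - 1 = _
    rw [map_mul, map_pow]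
    set d := algebraMap (𝓞 (maximalRealSubfield K)) (𝓞 K) b
    linear_combination ((x : 𝓞 K) * c x * d) ^ 2 * hζ' +
      ((x : 𝓞 K) * c x * d + 1 + f * s) * hb
  let Y : (A.toSubring ⧸ modIdeal A.toSubring f)ˣ :=
    ⟨Ideal.Quotient.mk _ y, Ideal.Quotient.mk _ y', hyy, by rw [mul_comm, hyy]⟩
  let z : B.toSubringˣ := Units.ofPowEqOne ζ m hζ hm
  have hz : z ∈ CommGroup.torsion B.toSubringˣ :=
    isOfFinOrder_iff_pow_eq_one.mpr ⟨m, Nat.pos_of_ne_zero hm, Units.pow_ofPowEqOne hζ hm⟩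
  have key : u ^ 2 * Units.map (Ideal.Quotient.mk (modIdeal B.toSubring f)).toMonoidHom z =
      Units.map (Ideal.quotientMap (modIdeal B.toSubring f) (Subring.inclusion h)
        (modIdeal_le_comap h f)).toMonoidHom Y := by
    ext1
    rw [Units.val_mul, Units.val_pow_eq_pow_val, ← hu]
    change Ideal.Quotient.mk _ x ^ 2 * Ideal.Quotient.mk _ ζ =
      Ideal.Quotient.mk _ (Subring.inclusion h y)
    rw [← map_pow, ← map_mul]
    congr 1
    exact Subtype.ext (mul_comm _ _)
  rw [eq_mul_inv_of_mul_eq key]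
  exact mul_mem (Subgroup.mem_sup_left ⟨Y, rfl⟩)
    (inv_mem (Subgroup.mem_sup_right (Subgroup.mem_map_of_mem _ hz)))

/-- An element `x` whose norm is a unit of `A₀` modulo `f`. -/
lemma exists_mul_eq_one_add {A B : ConjOrder K} (h : A.toSubring ≤ B.toSubring) {f : ℕ}
    (hA : ∀ w : 𝓞 K, f * w ∈ A.toSubring)
    {u : (B.toSubring ⧸ modIdeal B.toSubring f)ˣ} {x : B.toSubring}
    (hu : Ideal.Quotient.mk _ x = (u : B.toSubring ⧸ modIdeal B.toSubring f))
    (hker : Units.map (normMod B f) u ∈ unitsSubgroup (ConjOrder.real_mono h) f) :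
    (x : 𝓞 K) * IsCMField.ringOfIntegersComplexConj K x ∈ A.toSubring ∧
    ∃ (b : A.real) (s : 𝓞 K), (x : 𝓞 K) * IsCMField.ringOfIntegersComplexConj K x *
      algebraMap (𝓞 (maximalRealSubfield K)) (𝓞 K) b = 1 + f * s := by
  obtain ⟨V, hV⟩ := hker
  obtain ⟨a, ha⟩ := Ideal.Quotient.mk_surjective (V : A.real ⧸ modIdeal A.real f)
  obtain ⟨b, hb⟩ := Ideal.Quotient.mk_surjective ((V⁻¹ : (A.real ⧸ modIdeal A.real f)ˣ) :
    A.real ⧸ modIdeal A.real f)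
  have h1 : Ideal.Quotient.mk (modIdeal A.real f) (a * b) = Ideal.Quotient.mk _ 1 := by
    rw [map_mul, ha, hb, Units.mul_inv, map_one]
  rw [Ideal.Quotient.eq, mem_modIdeal_iff] at h1
  obtain ⟨s, hs⟩ := h1
  have h2 : Ideal.Quotient.mk (modIdeal B.real f) (normHom B x) =
      Ideal.Quotient.mk _ (Subring.inclusion (ConjOrder.real_mono h) a) := by
    have := congrArg Units.val hV
    change Ideal.quotientMap _ _ _ (V : A.real ⧸ modIdeal A.real f) = normMod B f u at this
    rw [← ha, ← hu] at this
    exact this.symm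
  rw [Ideal.Quotient.eq, mem_modIdeal_iff] at h2
  obtain ⟨s', hs'⟩ := h2
  replace hs' : ((normHom B x : B.real) : 𝓞 (maximalRealSubfield K)) - a = f * s' := hs'
  have e1 : algebraMap _ (𝓞 K) ((normHom B x : B.real) : 𝓞 (maximalRealSubfield K)) =
    (x : 𝓞 K) * IsCMField.ringOfIntegersComplexConj K x := algebraMap_norm _
  set ι := algebraMap (𝓞 (maximalRealSubfield K)) (𝓞 K) with hι
  have e2 : (x : 𝓞 K) * IsCMField.ringOfIntegersComplexConj K x = ι a + f * ι s' := by
    have := congrArg ι hs'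
    rw [map_sub, e1, map_mul, map_natCast] at this
    rw [← this]
    ring
  have e3 : ι a * ι b - 1 = f * ι s := by
    have := congrArg ι hs
    simpa using this
  refine ⟨?_, b, ι s + ι s' * ι b, ?_⟩
  · rw [e2]
    exact add_mem a.2 (hA _)
  · rw [e2]
    linear_combination e3

end Main

end QuarticCM

open QuarticCM in
theorem mainTheorem7 {K : Type*} [Field K] [NumberField K] [IsCMField K]
    (hdeg : Module.finrank ℚ K = 4)
    (hbiq : ¬ IsKleinFour (K ≃ₐ[ℚ] K))
    (Φ : Finset (K →+* ℂ)) (hΦ : QuarticCM.IsCMType Φ)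
    (O O' : QuarticCM.ConjOrder K)
    (hζ : IsCyclotomicExtension {5} ℚ K → O.toSubring = ⊤ ∨ O'.toSubring = ⊤)
    (f : ℕ) (hf : f = (O.inter O').index)
    (hS : QuarticCM.reflexKernel Φ O f ⊆ QuarticCM.reflexKernel Φ O' f) :
    ∀ x ∈ (QuarticCM.relNorm (A := O.inter O') (B := O) inf_le_left f).ker, x ^ 2 = 1 := by
  intro X hX
  obtain ⟨u, rfl⟩ := QuotientGroup.mk_surjective X
  have hker : Units.map (normMod O f) u ∈
      unitsSubgroup (ConjOrder.real_mono (A := O.inter O') (B := O) inf_le_left) f :=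
    (QuotientGroup.eq_one_iff _).mp hX
  rw [← QuotientGroup.mk_pow, QuotientGroup.eq_one_iff]
  have hA : ∀ w : 𝓞 K, f * w ∈ (O.inter O').toSubring := fun w => by
    rw [hf]
    exact (O.inter O').index_mul_mem w
  have hle : (O.inter O').toSubring ≤ O.toSubring := inf_le_left
  obtain ⟨x, hx0, hu⟩ := exists_ne_zero_lift (hf ▸ (O.inter O').index_ne_zero)
    (u : O.toSubring ⧸ modIdeal O.toSubring f)
  have hxK : ((x : 𝓞 K) : K) ≠ 0 := by simpa using hx0
  obtain ⟨hxx, b, s, hb⟩ := exists_mul_eq_one_add hle hA hu hker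
  have hcop : IsCoprime x (f : O.toSubring) :=
    isCoprime_of_isUnit_mk (fun w => (hA w).1) (hu ▸ u.isUnit)
  have hcop' : IsCoprime (x : 𝓞 K) (f : 𝓞 K) := by simpa using hcop.map O.toSubring.subtype
  obtain ⟨D⟩ := nonempty_reflexData hdeg hbiq hΦ (NormalClosure K)
  obtain ⟨ζ, m, hm, hpow, hmem⟩ : ∃ (ζ : O.toSubring) (m : ℕ), m ≠ 0 ∧ ζ ^ m = 1 ∧
      (ζ : 𝓞 K) * (x : 𝓞 K) ^ 2 ∈ O'.toSubring := by
    -- When `O'` is maximal, membership in it is automatic and `ζ = 1` serves; the root of unity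
    -- coming from the kernel might not lie in `O`.
    by_cases hO' : O'.toSubring = ⊤
    · exact ⟨1, 1, one_ne_zero, one_pow 1, hO' ▸ Subring.mem_top _⟩
    obtain ⟨ζ, ⟨m, hm, hpow⟩, t, -, i, hi, heq⟩ := D.exists_of_principal_mem_reflexKernel hdeg O' hxK
      (hS (D.principal_mem_reflexKernel hdeg O hxK hcop))
    have hmem := O'.mul_sq_mem (fun w => (hA w).2) (isCoprime_norm hcop') hi hxx.2 heq
    -- If `O` is not maximal either, the hypothesis on `ℚ(ζ₅)` excludes that field, so `ζ = ±1`.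
    have hζO : ζ ∈ O.toSubring := by
      by_cases hO : O.toSubring = ⊤
      · exact hO ▸ Subring.mem_top ζ
      have hsq := D.sq_eq_one_of_pow_eq_one hdeg (fun h => (hζ h).elim hO hO') hm hpow
      rcases mul_self_eq_one_iff.mp ((sq _).symm.trans hsq) with h | h
      · rw [show ζ = 1 from RingOfIntegers.ext (by simpa using h)]
        exact one_mem _
      · rw [show ζ = -1 from RingOfIntegers.ext (by simpa using h)]
        exact neg_mem (one_mem _)
    exact ⟨⟨ζ, hζO⟩, m, hm, Subtype.ext (RingOfIntegers.ext (by simpa using hpow)), hmem⟩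
  exact sq_mem_of_mul_sq_mem hle hu hb hm hpow
    ⟨O.toSubring.mul_mem ζ.2 (O.toSubring.pow_mem x.2 2), hmem⟩
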